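/- Let $k$ be a field (for instance an algebraically closed field of characteristic $p$ dividing $|G|$), $G$ a finite group, and $w$ a finite-dimensional $kG$-module with dual $w^*$. A $kG$-module is called $w$-projective if it is a direct summand of $w\otimes X$ for some $kG$-module $X$. The relatively stable category $\underline{\mathrm{Mod}}_w(kG)$ has all $kG$-modules as objects, and its morphisms are the module homomorphisms modulo those that factor through a $w$-projective module; write $[\alpha]$ for the class of $\alpha$. Its shift is $X\mapsto X[1]=\Omega_w^{-1}X$, the cokernel of the unit $X\to w\otimes w^*\otimes X$, $x\mapsto\sum_i e_i\otimes e_i^*\otimes x$. Its distinguished triangles are those isomorphic to a triangle $X\to Y\to Z\to X[1]$ coming from a short exact sequence of modules $0\to X\to Y\to Z\to 0$ that splits upon tensoring with $w$, where $Z\to X[1]$ is the connecting map given by a morphism of sequences, identical on $X$, to $X\to w\otimes w^*\otimes X\to\Omega_w^{-1}X$. Let $\mathcal L$ be the smallest thick triangulated subcategory of $\underline{\mathrm{Mod}}_w(kG)$ that is closed under all direct sums and contains all finite-dimensional modules. A Bousfield triangle of an object $M$ for $\mathcal L$ is a distinguished triangle $$\mathcal E_{\mathcal L}(M)\to M\to\mathcal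 F_{\mathcal L}(M)\to\mathcal E_{\mathcal L}(M)[1]$$ such that $\mathcal E_{\mathcal L}(M)\in\mathcal L$, every morphism from an object of $\mathcal L$ to $M$ factors through $\mathcal E_{\mathcal L}(M)\to M$, and every morphism from an object of $\mathcal L$ to $\mathcal F_{\mathcal L}(M)$ is zero. Let $M$ be a $kG$-module with $\dim_k M\le\aleph_0$. Then $M$ is the direct limit of a sequence of finite-dimensional submodules. Let $m_0\to m_1\to\cdots$ be any sequence of finite-dimensional $kG$-modules with direct limit $M$ (in particular, any such sequence of submodules), let $s:\bigoplus m_i\to\bigoplus m_i$ be the map induced by the maps $m_i\to m_{i+1}$, and let $t:\bigoplus m_i\to M$ be the map induced by the maps $m_i\to M$. Then: 1. There is a homotopy colimit of the sequence, i.e. a distinguished triangle $$\bigoplus m_i\xrightarrow{[1-s]}\bigoplus m_i\xrightarrow{t'}\mathrm{hocolim}(m_i)\to\Bigl(\bigoplus m_i\Bigr)[1].$$ 2. For every such triangle there is a morphism $[\lambda]:\mathrm{hocolim}(m_i)\to M$ with $[\lambda]\,t'=[t]$. 3. Every such $[\lambda]$ can be completed to a distinguished triangle $$\mathrm{hocolim}(m_i)\xrightarrow{[\lambda]}M\to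 M'\to\mathrm{hocolim}(m_i)[1],$$ and every such completion is a Bousfield triangle of $M$ for $\mathcal L$. 4. For every Bousfield triangle $\mathcal E_{\mathcal L}(M)\to M\to\mathcal F_{\mathcal L}(M)\to\mathcal E_{\mathcal L}(M)[1]$ and every triangle as in 3, there is a unique isomorphism $\mathcal E_{\mathcal L}(M)\cong\mathrm{hocolim}(m_i)$ in $\underline{\mathrm{Mod}}_w(kG)$ under which $\mathcal E_{\mathcal L}(M)\to M$ corresponds to $[\lambda]$, and, together with $\mathrm{id}_M$ and some isomorphism $\mathcal F_{\mathcal L}(M)\cong M'$, it forms an isomorphism of distinguished triangles. -/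

import Mathlib

open CategoryTheory Limits MonoidalCategory

universe u v

noncomputable section

namespace RelStable

variable {k : Type u} [Field k] {G : Type v} [Group G]

/-! ### The dual of a finite-dimensional module and the adjunction given by it -/

/-- The dual `w^*` of a `kG`-module `w`. -/
abbrev dual (w : Rep.{u} k G) : Rep.{u} k G := Rep.of w.ρ.dual

/-- The evaluation `w^* ⊗ w ⟶ k`. -/
def ev (w : Rep.{u} k G) : dual w ⊗ w ⟶ 𝟙_ (Rep.{u} k G) :=
  Rep.ofHom (σ := Representation.trivial k G k)
    { contractLeft k w.V with
      isIntertwining' := by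
        intro g
        apply TensorProduct.ext'
        intro f x
        simp [Representation.tprod_apply, Module.Dual.transpose_apply] }

theorem coevaluation_invariant (w : Rep.{u} k G) [FiniteDimensional k w.V] (g : G) :
    TensorProduct.map (w.ρ g) (w.ρ.dual g) (coevaluation k w.V 1) = coevaluation k w.V 1 := by
  apply (TensorProduct.comm k w.V (Module.Dual k w.V)).injective
  apply (dualTensorHomEquiv k w.V w.V).injective
  have hid : dualTensorHom k w.V w.V
      (TensorProduct.comm k w.V (Module.Dual k w.V) (coevaluation k w.V 1)) =
        LinearMap.id := by
    rw [coevaluation_apply_one]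
    apply (Module.Basis.ofVectorSpace k w.V).ext
    intro j
    simp only [map_sum, TensorProduct.comm_tmul, LinearMap.sum_apply, dualTensorHom_apply,
      Module.Basis.coord_apply, LinearMap.id_apply]
    exact (Module.Basis.ofVectorSpace k w.V).sum_repr _
  have hc := LinearMap.congr_fun (Representation.dualTensorHom_comm w.ρ w.ρ g)
    (TensorProduct.comm k w.V (Module.Dual k w.V) (coevaluation k w.V 1))
  have hm : TensorProduct.comm k w.V (Module.Dual k w.V)
      (TensorProduct.map (w.ρ g) (w.ρ.dual g) (coevaluation k w.V 1)) =
      TensorProduct.map (w.ρ.dual g) (w.ρ g)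
        (TensorProduct.comm k w.V (Module.Dual k w.V) (coevaluation k w.V 1)) := by
    rw [TensorProduct.map_comm]
  simp only [LinearMap.comp_apply] at hc
  rw [hm]
  change dualTensorHom k w.V w.V _ = dualTensorHom k w.V w.V _
  rw [hc, hid]
  ext x
  simp [Representation.linHom_apply]

/-- The coevaluation `k ⟶ w ⊗ w^*`, sending `1` to `∑ i, e i ⊗ e^* i`. -/
def coev (w : Rep.{u} k G) [FiniteDimensional k w.V] : 𝟙_ (Rep.{u} k G) ⟶ w ⊗ dual w :=
  Rep.ofHom (ρ := Representation.trivial k G k)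
    { coevaluation k w.V with
      isIntertwining' := by
        intro g
        apply LinearMap.ext_ring
        simpa [Representation.tprod_apply] using (coevaluation_invariant w g).symm }

/-- `w^*` is a dual of `w` in the monoidal category of `kG`-modules. -/
instance exactPairing (w : Rep.{u} k G) [FiniteDimensional k w.V] :
    ExactPairing w (dual w) where
  coevaluation' := coev w
  evaluation' := ev w
  coevaluation_evaluation' := by
    apply Rep.hom_ext
    apply Representation.IntertwiningMap.toLinearMap_injective
    exact contractLeft_assoc_coevaluation k w.V
  evaluation_coevaluation' := by
    apply Rep.hom_ext
    apply Representation.IntertwiningMap.toLinearMap_injective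
    exact contractLeft_assoc_coevaluation' k w.V

section

variable (w : Rep.{u} k G)

/-- A module is `w`-projective when it is a direct summand of `w ⊗ X` for some module `X`. -/
def IsRelProjective (P : Rep.{u} k G) : Prop :=
  ∃ X : Rep.{u} k G, Nonempty (Retract P (w ⊗ X))

/-- `α ∼ β` when `α - β` factors through a `w`-projective module. -/
def stableRel : HomRel (Rep.{u} k G) := fun X Y α β =>
  ∃ (P : Rep.{u} k G) (_ : IsRelProjective w P) (a : X ⟶ P) (b : P ⟶ Y), α - β = a ≫ b

theorem IsRelProjective.biprod {P P' : Rep.{u} k G} (h : IsRelProjective w P)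
    (h' : IsRelProjective w P') : IsRelProjective w (P ⊞ P') := by
  obtain ⟨X, ⟨r⟩⟩ := h
  obtain ⟨X', ⟨r'⟩⟩ := h'
  refine ⟨X ⊞ X', ⟨⟨biprod.desc (r.i ≫ w ◁ biprod.inl) (r'.i ≫ w ◁ biprod.inr),
    biprod.lift (w ◁ biprod.fst ≫ r.r) (w ◁ biprod.snd ≫ r'.r), ?_⟩⟩⟩
  have h₁ : (r.i ≫ w ◁ biprod.inl) ≫ w ◁ (biprod.fst : X ⊞ X' ⟶ X) ≫ r.r = 𝟙 P := by
    rw [Category.assoc, ← MonoidalCategory.whiskerLeft_comp_assoc]; simp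
  have h₂ : (r.i ≫ w ◁ biprod.inl) ≫ w ◁ (biprod.snd : X ⊞ X' ⟶ X') ≫ r'.r = 0 := by
    rw [Category.assoc, ← MonoidalCategory.whiskerLeft_comp_assoc]; simp
  have h₃ : (r'.i ≫ w ◁ biprod.inr) ≫ w ◁ (biprod.fst : X ⊞ X' ⟶ X) ≫ r.r = 0 := by
    rw [Category.assoc, ← MonoidalCategory.whiskerLeft_comp_assoc]; simp
  have h₄ : (r'.i ≫ w ◁ biprod.inr) ≫ w ◁ (biprod.snd : X ⊞ X' ⟶ X') ≫ r'.r = 𝟙 P' := by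
    rw [Category.assoc, ← MonoidalCategory.whiskerLeft_comp_assoc]; simp
  apply biprod.hom_ext' <;> apply biprod.hom_ext <;>
    simp only [biprod.inl_desc_assoc, biprod.inr_desc_assoc, Category.assoc, biprod.lift_fst,
      biprod.lift_snd, Category.comp_id, biprod.inl_fst, biprod.inl_snd, biprod.inr_fst,
      biprod.inr_snd] <;>
    simpa only [Category.assoc] using ‹_›

theorem stableRel_add ⦃X Y : Rep.{u} k G⦄ (f₁ f₂ g₁ g₂ : X ⟶ Y)
    (hf : stableRel w f₁ f₂) (hg : stableRel w g₁ g₂) :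
    stableRel w (f₁ + g₁) (f₂ + g₂) := by
  obtain ⟨P, hP, a, b, e⟩ := hf
  obtain ⟨P', hP', a', b', e'⟩ := hg
  refine ⟨P ⊞ P', hP.biprod w hP', biprod.lift a a', biprod.desc b b', ?_⟩
  rw [biprod.lift_desc, ← e, ← e']
  abel

instance : Congruence (stableRel w) where
  equivalence :=
    { refl := fun f => ⟨w ⊗ 𝟙_ _, ⟨_, ⟨Retract.refl _⟩⟩, 0, 0, by simp⟩
      symm := by
        rintro f g ⟨P, hP, a, b, e⟩
        exact ⟨P, hP, -a, b, by rw [Preadditive.neg_comp, ← e]; abel⟩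
      trans := by
        rintro f g h ⟨P, hP, a, b, e⟩ ⟨P', hP', a', b', e'⟩
        refine ⟨P ⊞ P', hP.biprod w hP', biprod.lift a a', biprod.desc b b', ?_⟩
        rw [biprod.lift_desc, ← e, ← e']
        abel }
  comp_left := by
    rintro X Y Z f g g' ⟨P, hP, a, b, e⟩
    exact ⟨P, hP, f ≫ a, b, by rw [← Preadditive.comp_sub, e, Category.assoc]⟩
  comp_right := by
    rintro X Y Z f f' g ⟨P, hP, a, b, e⟩
    exact ⟨P, hP, a, b ≫ g, by rw [← Preadditive.sub_comp, e, Category.assoc]⟩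

/-- The relatively stable category: all `kG`-modules, with morphisms taken modulo those that
factor through a `w`-projective module. -/
abbrev StMod : Type _ := CategoryTheory.Quotient (stableRel w)

instance : Preadditive (StMod w) := CategoryTheory.Quotient.preadditive _ (stableRel_add w)

/-- The quotient functor `X ↦ X`, `α ↦ [α]`. -/
abbrev toStable : Rep.{u} k G ⥤ StMod w := CategoryTheory.Quotient.functor (stableRel w)

instance : (toStable w).Additive := CategoryTheory.Quotient.functor_additive _ (stableRel_add w)

variable [FiniteDimensional k w.V]

/-- The canonical `w`-injective hull `w ⊗ (w^* ⊗ X)`. -/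
abbrev hull : Rep.{u} k G ⥤ Rep.{u} k G := tensorLeft (dual w) ⋙ tensorLeft w

/-- The unit `X ⟶ w ⊗ (w^* ⊗ X)`, `x ↦ ∑ i, e i ⊗ (e^* i ⊗ x)`. -/
abbrev hullUnit : 𝟭 (Rep.{u} k G) ⟶ hull w := (tensorLeftAdjunction w (dual w)).unit

/-- The cokernel of the unit, as a functor on modules. -/
def preShift : Rep.{u} k G ⥤ Rep.{u} k G where
  obj X := cokernel ((hullUnit w).app X)
  map f := cokernel.map _ _ f ((hull w).map f) ((hullUnit w).naturality f).symm
  map_id X := by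
    rw [← cancel_epi (cokernel.π _)]
    simp
  map_comp f g := by
    rw [← cancel_epi (cokernel.π _)]
    simp

/-- The projection `w ⊗ (w^* ⊗ X) ⟶ Ω_w⁻¹ X`. -/
def preShiftProj : hull w ⟶ preShift w where
  app X := cokernel.π ((hullUnit w).app X)
  naturality X Y f := by simp [preShift]

theorem hullUnit_comp_proj (X : Rep.{u} k G) :
    (hullUnit w).app X ≫ (preShiftProj w).app X = 0 :=
  cokernel.condition _

instance (X : Rep.{u} k G) : Epi ((preShiftProj w).app X) :=
  inferInstanceAs (Epi (cokernel.π _))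

theorem preShift_isRelProjective {P : Rep.{u} k G} (hP : IsRelProjective w P) :
    IsRelProjective w ((preShift w).obj P) := by
  obtain ⟨X, ⟨r⟩⟩ := hP
  let Y := w ⊗ X
  let ρ : (hull w).obj Y ⟶ Y := w ◁ (tensorLeftAdjunction w (dual w)).counit.app X
  have hρ : (hullUnit w).app Y ≫ ρ = 𝟙 Y :=
    (tensorLeftAdjunction w (dual w)).right_triangle_components X
  let σ : (preShift w).obj Y ⟶ (hull w).obj Y :=
    cokernel.desc _ (𝟙 _ - ρ ≫ (hullUnit w).app Y) (by
      rw [Preadditive.comp_sub, reassoc_of% hρ]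
      simp)
  have hσ : σ ≫ (preShiftProj w).app Y = 𝟙 _ := by
    rw [← cancel_epi ((preShiftProj w).app Y)]
    have h₁ : (preShiftProj w).app Y ≫ σ = 𝟙 _ - ρ ≫ (hullUnit w).app Y :=
      cokernel.π_desc _ _ _
    rw [reassoc_of% h₁, Preadditive.sub_comp, Category.assoc, hullUnit_comp_proj]
    simp
  exact ⟨(dual w) ⊗ Y, ⟨(r.map (preShift w)).trans ⟨σ, (preShiftProj w).app Y, hσ⟩⟩⟩

instance : (preShift w).Additive where
  map_add {X Y f g} := by
    rw [← cancel_epi ((preShiftProj w).app X), Preadditive.comp_add]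
    simp only [← NatTrans.naturality, Functor.map_add, Preadditive.add_comp]

theorem preShift_sound (X Y : Rep.{u} k G) (f g : X ⟶ Y) (h : stableRel w f g) :
    (preShift w ⋙ toStable w).map f = (preShift w ⋙ toStable w).map g := by
  obtain ⟨P, hP, a, b, e⟩ := h
  apply CategoryTheory.Quotient.sound
  refine ⟨_, preShift_isRelProjective w hP, (preShift w).map a, (preShift w).map b, ?_⟩
  rw [← Functor.map_comp, ← e, Functor.map_sub]

/-- The shift functor `Ω_w⁻¹` of the relatively stable category. -/
def shift : StMod w ⥤ StMod w :=
  CategoryTheory.Quotient.lift _ (preShift w ⋙ toStable w) (preShift_sound w)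

/-- A triangle `X ⟶ Y ⟶ Z ⟶ Ω_w⁻¹ X` in the relatively stable category. -/
structure Tri where
  {X Y Z : StMod w}
  f : X ⟶ Y
  g : Y ⟶ Z
  h : Z ⟶ (shift w).obj X

variable {w}

/-- A short exact sequence of modules is `w`-split when it splits upon tensoring with `w`. -/
def IsWSplit (w : Rep.{u} k G) (S : ShortComplex (Rep.{u} k G)) : Prop :=
  S.ShortExact ∧ Nonempty (S.map (tensorLeft w)).Splitting

/-- `δ : S.X₃ ⟶ Ω_w⁻¹ S.X₁` is a connecting map of `S` when there is a commutative ladder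
from `S` to `S.X₁ ⟶ w ⊗ (w^* ⊗ S.X₁) ⟶ Ω_w⁻¹ S.X₁` starting with the identity of `S.X₁`. -/
def IsConnecting (S : ShortComplex (Rep.{u} k G)) (δ : S.X₃ ⟶ (preShift w).obj S.X₁) : Prop :=
  ∃ e : S.X₂ ⟶ (hull w).obj S.X₁,
    S.f ≫ e = (hullUnit w).app S.X₁ ∧ e ≫ (preShiftProj w).app S.X₁ = S.g ≫ δ

/-- The distinguished triangles: those isomorphic, in the relatively stable category, to the
triangle of a `w`-split short exact sequence. -/
def Tri.Distinguished (T : Tri w) : Prop :=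
  ∃ (S : ShortComplex (Rep.{u} k G)) (δ : S.X₃ ⟶ (preShift w).obj S.X₁)
    (_ : IsWSplit w S) (_ : IsConnecting S δ)
    (a : T.X ≅ (toStable w).obj S.X₁) (b : T.Y ≅ (toStable w).obj S.X₂)
    (c : T.Z ≅ (toStable w).obj S.X₃),
    T.f ≫ b.hom = a.hom ≫ (toStable w).map S.f ∧
    T.g ≫ c.hom = b.hom ≫ (toStable w).map S.g ∧
    T.h ≫ (shift w).map a.hom = c.hom ≫ (toStable w).map δ

/-- A localizing subcategory, given by its objects: a full thick triangulated subcategory closed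
under all (small) direct sums. Closure under isomorphisms is the case of an invertible retract,
and the other two-out-of-three properties for triangles follow from `cone` by rotation. -/
structure IsLocalizing (P : ObjectProperty (StMod w)) : Prop where
  shift_iff : ∀ X, P ((shift w).obj X) ↔ P X
  cone : ∀ T : Tri w, T.Distinguished → P T.X → P T.Y → P T.Z
  retract : ∀ X Y, Retract X Y → P Y → P X
  coproduct : ∀ (ι : Type u) (X : ι → StMod w) (c : Cofan X), IsColimit c →
    (∀ i, P (X i)) → P c.pt

variable (w) in
/-- The localizing subcategory `ℒ` generated by the finite-dimensional modules. -/
def locFD : ObjectProperty (StMod w) := fun X =>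
  ∀ P : ObjectProperty (StMod w), IsLocalizing P →
    (∀ x : Rep.{u} k G, FiniteDimensional k x.V → P ((toStable w).obj x)) → P X

/-- `E ⟶ M ⟶ F ⟶ Ω_w⁻¹ E` is a Bousfield triangle for `L`: it is distinguished, `E` lies in `L`,
every morphism from an object of `L` to `M` factors through `E ⟶ M`, and `F` is `L`-local. -/
structure IsBousfield (L : ObjectProperty (StMod w)) (T : Tri w) : Prop where
  distinguished : T.Distinguished
  mem : L T.X
  factors : ∀ l, L l → ∀ φ : l ⟶ T.Y, ∃ ψ : l ⟶ T.X, ψ ≫ T.f = φ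
  isLocal : ∀ l, L l → ∀ φ : l ⟶ T.Z, φ = 0

/-- The map `1 - s : ⨁ m i ⟶ ⨁ m i` of modules, where `s` is given by the `m i ⟶ m (i + 1)`. -/
def oneSubShift (m : ℕ ⥤ Rep.{u} k G) : (∐ fun i => m.obj i) ⟶ ∐ fun i => m.obj i :=
  Sigma.desc fun i => Sigma.ι (fun i => m.obj i) i -
    m.map (homOfLE (Nat.le_succ i)) ≫ Sigma.ι (fun i => m.obj i) (i + 1)

/-- The map `t : ⨁ m i ⟶ M` of modules induced by a cocone with vertex `M`. -/
def sumMap {m : ℕ ⥤ Rep.{u} k G} (c : Cocone m) : (∐ fun i => m.obj i) ⟶ c.pt :=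
  Sigma.desc fun i => c.ι.app i

/-- `H`, with `t'` and `δ`, is a homotopy colimit of the sequence `m`: it completes `[1 - s]` to a
distinguished triangle. -/
def IsHocolim (m : ℕ ⥤ Rep.{u} k G) {H : StMod w}
    (t' : (toStable w).obj (∐ fun i => m.obj i) ⟶ H)
    (δ : H ⟶ (shift w).obj ((toStable w).obj (∐ fun i => m.obj i))) : Prop :=
  Tri.Distinguished ⟨(toStable w).map (oneSubShift m), t', δ⟩

end

end RelStable

end

open RelStable

/-! The sequence `0 → ⨁ m i → ⨁ m i → M → 0` is exact but need not split after tensoring with `w`,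
so the homotopy colimit `H` is in general not `M`. Finite-dimensional modules cannot tell the two
apart: for `x` finite-dimensional, composition with `[λ]` is a bijection from stable maps `x ⟶ H` to
stable maps `x ⟶ M`. It is surjective because a module map `x ⟶ M` factors through some `m i`
(`exists_comp_ι_eq`). For injectivity, a stable map `x ⟶ H` comes from some stage
(`IsHocolim.exists_factor`); if its image in `M` is null, that image factors through `w ⊗ (w^* ⊗
x)`, which is again finite-dimensional, so the factorization already exists at a later stage
(`IsHocolim.eq_zero_of_comp_lam`).

By the long exact sequence, the cone `M'` of `[λ]` receives no nonzero map from a finite-dimensional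
module (`IsHocolim.fdLocal`). The objects without nonzero maps to all targets of this kind form a
localizing subcategory containing the finite-dimensional modules, hence containing `ℒ`
(`eq_zero_of_locFD`). Since `H` lies in `ℒ`, the triangle is a Bousfield triangle, and orthogonality
gives uniqueness.

The triangulated input (exact Hom sequences, rotation, completion of squares, five lemma, the shift
being an equivalence) rests on `w`-projectives being both injective and projective relative to
`w`-split sequences, and on the unit being a monomorphism, which requires `w ≠ 0`. For `w = 0` the
stable category is the module category with zero shift, triangles are short exact sequences, and
`[λ]` is an isomorphism. -/

noncomputable section

namespace RelStable

section

/-! ### Functors with an adjoint with which they commute -/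

section

variable {C : Type*} [Category* C] {D L : C ⥤ C}

/-- If `D ⊣ L` and the two functors commute, then `D` inverts on the left every retraction of
`L.map f`. -/
theorem exists_retraction_of_adj (adj : D ⊣ L) (c : L ⋙ D ≅ D ⋙ L) {X Y : C} (f : X ⟶ Y)
    (h : ∃ r, L.map f ≫ r = 𝟙 _) : ∃ r, D.map f ≫ r = 𝟙 _ := by
  obtain ⟨r, hr⟩ := h
  -- By a triangle identity `D f` is a retract of `D L D f ≅ D D L f` in the arrow category, and the
  -- latter has the retraction `D D r`.
  refine ⟨D.map (adj.unit.app Y) ≫ D.map (c.inv.app Y) ≫ D.map (D.map r) ≫ D.map (c.hom.app X) ≫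
    adj.counit.app (D.obj X), ?_⟩
  have h₁ := adj.unit.naturality f
  have h₂ := c.inv.naturality f
  simp only [Functor.id_map, Functor.comp_map, Functor.comp_obj, Functor.id_obj] at h₁ h₂
  rw [← D.map_comp_assoc, h₁, D.map_comp_assoc, ← D.map_comp_assoc (L.map (D.map f)), h₂,
    D.map_comp_assoc, ← D.map_comp_assoc (D.map (L.map f)), ← D.map_comp, hr]
  simp [← D.map_comp_assoc]

/-- Again `D g` is a retract of `D D L g`, which is split because `L g` is. -/
theorem exists_section_of_adj (adj : D ⊣ L) (c : L ⋙ D ≅ D ⋙ L) {X Y : C} (g : X ⟶ Y)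
    (h : ∃ s, s ≫ L.map g = 𝟙 _) : ∃ s, s ≫ D.map g = 𝟙 _ := by
  obtain ⟨s, hs⟩ := h
  refine ⟨D.map (adj.unit.app Y) ≫ D.map (c.inv.app Y) ≫ D.map (D.map s) ≫ D.map (c.hom.app X) ≫
    adj.counit.app (D.obj X), ?_⟩
  have h₁ := adj.counit.naturality (D.map g)
  have h₂ := c.hom.naturality g
  simp only [Functor.id_map, Functor.comp_map, Functor.comp_obj, Functor.id_obj] at h₁ h₂
  simp only [Category.assoc]
  rw [← h₁, ← D.map_comp_assoc (c.hom.app X), ← h₂, D.map_comp_assoc,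
    ← D.map_comp_assoc (D.map s), ← D.map_comp, hs]
  simp [← D.map_comp_assoc]

end

/-! ### Relative injectivity and projectivity for `w`-split sequences -/

variable {k : Type u} [Field k] {G : Type v} [Group G]

section

variable (w : Rep.{u} k G) [FiniteDimensional k w.V]

/-- Tensoring with `w^*` is left adjoint to tensoring with `w`. -/
abbrev dualAdj : tensorLeft (dual w) ⊣ tensorLeft w := tensorLeftAdjunction w (dual w)

/-- Tensoring with `w` is left adjoint to tensoring with `w^*`. -/
abbrev dualAdj' : tensorLeft w ⊣ tensorLeft (dual w) :=
  letI := BraidedCategory.exactPairing_swap w (dual w)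
  tensorLeftAdjunction (dual w) w

/-- Tensoring with `X` and tensoring with `Y` commute. -/
def tensorLeftComm (X Y : Rep.{u} k G) :
    tensorLeft X ⋙ tensorLeft Y ≅ tensorLeft Y ⋙ tensorLeft X :=
  NatIso.ofComponents (fun Z => (α_ Y X Z).symm ≪≫ whiskerRightIso (β_ Y X) Z ≪≫ α_ X Y Z)
    (fun f => by
      simp only [Iso.trans_hom, Iso.symm_hom, whiskerRightIso_hom, Category.assoc]
      change Y ◁ X ◁ f ≫ _ ≫ _ ≫ _ = _ ≫ _ ≫ _ ≫ X ◁ Y ◁ f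
      rw [associator_inv_naturality_right_assoc, whisker_exchange_assoc,
        associator_naturality_right])

omit [FiniteDimensional k w.V] in
theorem isRelProjective_tensor (X : Rep.{u} k G) : IsRelProjective w (w ⊗ X) :=
  ⟨X, ⟨Retract.refl _⟩⟩

/-- The canonical map `w^* ⊗ (w ⊗ X) ⟶ X`. -/
abbrev coverMap (X : Rep.{u} k G) : dual w ⊗ (w ⊗ X) ⟶ X := (dualAdj w).counit.app X

omit [FiniteDimensional k w.V] in
theorem isRelProjective_cover (X : Rep.{u} k G) : IsRelProjective w (dual w ⊗ (w ⊗ X)) :=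
  ⟨dual w ⊗ X, ⟨((tensorLeftComm w (dual w)).app X).retract⟩⟩

variable {w}

/-- By adjunction a map to `w ⊗ X` is a map from `w^* ⊗ S.X₁` to `X`, and `w^* ⊗ S.f` is a split
monomorphism because `w ⊗ S.f` is. -/
theorem IsWSplit.extend_tensor {S : ShortComplex (Rep.{u} k G)} (hS : IsWSplit w S)
    {X : Rep.{u} k G} (φ : S.X₁ ⟶ w ⊗ X) : ∃ ψ : S.X₂ ⟶ w ⊗ X, S.f ≫ ψ = φ := by
  obtain ⟨r, hr⟩ := exists_retraction_of_adj (dualAdj w) (tensorLeftComm _ _) S.f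
    ⟨_, hS.2.some.f_r⟩
  refine ⟨(dualAdj w).homEquiv _ _ (r ≫ ((dualAdj w).homEquiv _ _).symm φ), ?_⟩
  rw [← Adjunction.homEquiv_naturality_left, reassoc_of% hr, Equiv.apply_symm_apply]

/-- The dual argument needs the other adjunction: a map out of `w ⊗ X` is a map from `X` to `w^* ⊗
S.X₃`. -/
theorem IsWSplit.lift_tensor {S : ShortComplex (Rep.{u} k G)} (hS : IsWSplit w S)
    {X : Rep.{u} k G} (φ : w ⊗ X ⟶ S.X₃) : ∃ ψ : w ⊗ X ⟶ S.X₂, ψ ≫ S.g = φ := by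
  obtain ⟨s, hs⟩ := exists_section_of_adj (dualAdj w) (tensorLeftComm _ _) S.g
    ⟨_, hS.2.some.s_g⟩
  refine ⟨((dualAdj' w).homEquiv _ _).symm ((dualAdj' w).homEquiv _ _ φ ≫ s), ?_⟩
  rw [← Adjunction.homEquiv_naturality_right_symm, Category.assoc, hs, Category.comp_id,
    Equiv.symm_apply_apply]

/-- `w`-projective modules are injective relative to `w`-split sequences. -/
theorem IsWSplit.extend {S : ShortComplex (Rep.{u} k G)} (hS : IsWSplit w S) {P : Rep.{u} k G}
    (hP : IsRelProjective w P) (φ : S.X₁ ⟶ P) : ∃ ψ : S.X₂ ⟶ P, S.f ≫ ψ = φ := by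
  obtain ⟨X, ⟨r⟩⟩ := hP
  obtain ⟨ψ, hψ⟩ := hS.extend_tensor (φ ≫ r.i)
  exact ⟨ψ ≫ r.r, by rw [reassoc_of% hψ, r.retract, Category.comp_id]⟩

/-- `w`-projective modules are projective relative to `w`-split sequences. -/
theorem IsWSplit.lift {S : ShortComplex (Rep.{u} k G)} (hS : IsWSplit w S) {P : Rep.{u} k G}
    (hP : IsRelProjective w P) (φ : P ⟶ S.X₃) : ∃ ψ : P ⟶ S.X₂, ψ ≫ S.g = φ := by
  obtain ⟨X, ⟨r⟩⟩ := hP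
  obtain ⟨ψ, hψ⟩ := hS.lift_tensor (r.r ≫ φ)
  exact ⟨r.i ≫ ψ, by rw [Category.assoc, hψ, r.retract_assoc]⟩

-- Tensoring is right exact, so a retraction of the first map determines the whole splitting.
omit [FiniteDimensional k w.V] in
theorem isWSplit_of_retraction {S : ShortComplex (Rep.{u} k G)} (hS : S.ShortExact)
    (h : ∃ r, w ◁ S.f ≫ r = 𝟙 _) : IsWSplit w S := by
  obtain ⟨r, hr⟩ := h
  have := hS.epi_g
  have : (S.map (tensorLeft w)).Exact :=
    (hS.exact.map_of_epi_of_preservesCokernel (tensorLeft w) inferInstance inferInstance)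
  have : Epi (S.map (tensorLeft w)).g := inferInstanceAs (Epi ((tensorLeft w).map S.g))
  exact ⟨hS, ⟨.ofExactOfRetraction _ ‹_› r hr this⟩⟩

theorem isWSplit_of_section {S : ShortComplex (Rep.{u} k G)} (hS : S.ShortExact)
    (h : ∃ s, s ≫ w ◁ S.g = 𝟙 _) : IsWSplit w S := by
  obtain ⟨s, hs⟩ := h
  have := hS.mono_f
  have := (dualAdj w).rightAdjoint_preservesLimits
  have : (S.map (tensorLeft w)).Exact :=
    (hS.exact.map_of_mono_of_preservesKernel (tensorLeft w) inferInstance inferInstance)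
  have : Mono (S.map (tensorLeft w)).f := inferInstanceAs (Mono ((tensorLeft w).map S.f))
  exact ⟨hS, ⟨.ofExactOfSection _ ‹_› s hs this⟩⟩

/-! ### The canonical `w`-split sequences -/

variable (w)

/-- A triangle identity splits the unit after tensoring with `w^*`; `exists_retraction_of_adj`
converts this into a splitting after tensoring with `w`. -/
theorem exists_retraction_hullUnit (X : Rep.{u} k G) :
    ∃ r, w ◁ (hullUnit w).app X ≫ r = 𝟙 _ :=
  exists_retraction_of_adj (dualAdj' w) (tensorLeftComm _ _) _
    ⟨_, (dualAdj w).left_triangle_components X⟩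

theorem exists_section_coverMap (X : Rep.{u} k G) : ∃ s, s ≫ w ◁ coverMap w X = 𝟙 _ :=
  ⟨_, (dualAdj w).right_triangle_components X⟩

theorem exists_section_preShiftProj (X : Rep.{u} k G) :
    ∃ s, s ≫ w ◁ (preShiftProj w).app X = 𝟙 _ := by
  obtain ⟨r, hr⟩ := exists_retraction_hullUnit w X
  have hex : ((ShortComplex.mk _ _ (hullUnit_comp_proj w X)).map (tensorLeft w)).Exact :=
    (ShortComplex.exact_of_g_is_cokernel _
      (cokernelIsCokernel ((hullUnit w).app X))).map_of_epi_of_preservesCokernel (tensorLeft w)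
      (inferInstanceAs (Epi ((preShiftProj w).app X))) inferInstance
  have : Epi ((tensorLeft w).map ((preShiftProj w).app X)) := inferInstance
  exact ⟨_, (ShortComplex.Splitting.ofExactOfRetraction _ hex r hr this).s_g⟩

variable [Nontrivial w.V]

-- A functional that does not vanish on a chosen `v ≠ 0` recovers `f x` from `v ⊗ f x` up to a
-- nonzero scalar. This is how `w ≠ 0` makes the unit monic and the counit epic.
omit [FiniteDimensional k w.V] in
theorem tensorLeft_faithful : (tensorLeft w).Faithful where
  map_injective {X Y f g} h := by
    obtain ⟨v, hv⟩ := exists_ne (0 : w.V)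
    obtain ⟨φ, hφ⟩ := Module.Projective.exists_dual_ne_zero k hv
    ext x
    have h₁ : v ⊗ₜ[k] f.hom x = v ⊗ₜ[k] g.hom x := congr(($h).hom (v ⊗ₜ[k] x))
    have h₂ := congr(TensorProduct.lid k Y.V (TensorProduct.map φ LinearMap.id $h₁))
    simp only [TensorProduct.map_tmul, TensorProduct.lid_tmul, LinearMap.id_apply] at h₂
    exact smul_right_injective _ hφ h₂

theorem mono_hullUnit (X : Rep.{u} k G) : Mono ((hullUnit w).app X) := by
  have := tensorLeft_faithful w
  obtain ⟨r, hr⟩ := exists_retraction_hullUnit w X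
  exact (tensorLeft w).mono_of_mono_map
    (SplitMono.mono (f := (tensorLeft w).map ((hullUnit w).app X)) ⟨r, hr⟩)

theorem epi_coverMap (X : Rep.{u} k G) : Epi (coverMap w X) := by
  have := tensorLeft_faithful w
  obtain ⟨s, hs⟩ := exists_section_coverMap w X
  exact (tensorLeft w).epi_of_epi_map
    (SplitEpi.epi (f := (tensorLeft w).map (coverMap w X)) ⟨s, hs⟩)

/-- The sequence `X ⟶ w ⊗ (w^* ⊗ X) ⟶ Ω_w⁻¹ X`. -/
abbrev hullSeq (X : Rep.{u} k G) : ShortComplex (Rep.{u} k G) :=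
  ShortComplex.mk _ _ (hullUnit_comp_proj w X)

theorem isWSplit_hullSeq (X : Rep.{u} k G) : IsWSplit w (hullSeq w X) :=
  isWSplit_of_retraction
    { exact := ShortComplex.exact_of_g_is_cokernel _ (cokernelIsCokernel ((hullUnit w).app X))
      mono_f := mono_hullUnit w X
      epi_g := inferInstanceAs (Epi ((preShiftProj w).app X)) }
    (exists_retraction_hullUnit w X)

/-- The sequence `Ω_w X ⟶ w^* ⊗ (w ⊗ X) ⟶ X`. -/
abbrev coverSeq (X : Rep.{u} k G) : ShortComplex (Rep.{u} k G) :=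
  ShortComplex.mk _ _ (kernel.condition (coverMap w X))

theorem isWSplit_coverSeq (X : Rep.{u} k G) : IsWSplit w (coverSeq w X) :=
  isWSplit_of_section
    { exact := ShortComplex.exact_of_f_is_kernel _ (kernelIsKernel (coverMap w X))
      mono_f := inferInstanceAs (Mono (kernel.ι _))
      epi_g := epi_coverMap w X }
    (exists_section_coverMap w X)

end

end

section

variable {k : Type u} [Field k] {G : Type v} [Group G]

/-! ### Maps that vanish in the relatively stable category -/

section

variable {w : Rep.{u} k G}

theorem toStable_map_eq_zero_iff {X Y : Rep.{u} k G} {f : X ⟶ Y} :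
    (toStable w).map f = 0 ↔
      ∃ (P : Rep.{u} k G) (_ : IsRelProjective w P) (a : X ⟶ P) (b : P ⟶ Y), a ≫ b = f := by
  rw [← (toStable w).map_zero X Y, CategoryTheory.Quotient.functor_map_eq_iff]
  simp only [stableRel, sub_zero, eq_comm]

theorem toStable_map_eq_iff {X Y : Rep.{u} k G} {f g : X ⟶ Y} :
    (toStable w).map f = (toStable w).map g ↔ (toStable w).map (f - g) = 0 := by
  rw [Functor.map_sub, sub_eq_zero]

theorem toStable_map_comp_eq_zero {X P Y : Rep.{u} k G} (hP : IsRelProjective w P) (a : X ⟶ P)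
    (b : P ⟶ Y) : (toStable w).map (a ≫ b) = 0 :=
  toStable_map_eq_zero_iff.2 ⟨P, hP, a, b, rfl⟩

theorem isZero_toStable_obj {P : Rep.{u} k G} (hP : IsRelProjective w P) :
    IsZero ((toStable w).obj P) := by
  rw [IsZero.iff_id_eq_zero, ← (toStable w).map_id, ← Category.comp_id (𝟙 P)]
  exact toStable_map_comp_eq_zero hP _ _

variable [FiniteDimensional k w.V] [Nontrivial w.V]

/-- The null factorization can go through a module that depends only on the source, and that is
finite-dimensional when the source is. -/
theorem exists_hullUnit_comp_eq {X Y : Rep.{u} k G} {f : X ⟶ Y} (h : (toStable w).map f = 0) :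
    ∃ g : (hull w).obj X ⟶ Y, (hullUnit w).app X ≫ g = f := by
  obtain ⟨P, hP, a, b, rfl⟩ := toStable_map_eq_zero_iff.1 h
  obtain ⟨a', ha'⟩ := (isWSplit_hullSeq w X).extend hP a
  exact ⟨a' ≫ b, by rw [← ha', Category.assoc]⟩

/-- Here the intermediate module depends only on the target, so null maps from many sources can be
factored simultaneously. -/
theorem exists_comp_coverMap_eq {X Y : Rep.{u} k G} {f : X ⟶ Y} (h : (toStable w).map f = 0) :
    ∃ g : X ⟶ dual w ⊗ (w ⊗ Y), g ≫ coverMap w Y = f := by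
  obtain ⟨P, hP, a, b, rfl⟩ := toStable_map_eq_zero_iff.1 h
  obtain ⟨b', hb'⟩ := (isWSplit_coverSeq w Y).lift hP b
  exact ⟨a ≫ b', by rw [← hb', Category.assoc]⟩

end

variable {w : Rep.{u} k G} [FiniteDimensional k w.V]

/-- The morphism `Z ⟶ X[1]` of the relatively stable category given by a morphism of modules
`Z ⟶ Ω_w⁻¹ X`. -/
def toShift {Z X : Rep.{u} k G} (δ : Z ⟶ (preShift w).obj X) :
    (toStable w).obj Z ⟶ (shift w).obj ((toStable w).obj X) :=
  (toStable w).map δ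

theorem map_comp_toShift {Y Z X : Rep.{u} k G} (g : Y ⟶ Z) (δ : Z ⟶ (preShift w).obj X) :
    (toStable w).map g ≫ toShift δ = toShift (g ≫ δ) :=
  ((toStable w).map_comp _ _).symm

theorem toShift_comp_shift_map {Z X Y : Rep.{u} k G} (δ : Z ⟶ (preShift w).obj X) (f : X ⟶ Y) :
    toShift δ ≫ (shift w).map ((toStable w).map f) = toShift (δ ≫ (preShift w).map f) :=
  ((toStable w).map_comp _ _).symm

theorem toShift_eq_zero_iff {Z X : Rep.{u} k G} {δ : Z ⟶ (preShift w).obj X} :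
    toShift δ = 0 ↔ (toStable w).map δ = 0 :=
  Iff.rfl

theorem toShift_eq_iff {Z X : Rep.{u} k G} {δ δ' : Z ⟶ (preShift w).obj X} :
    toShift δ = toShift δ' ↔ (toStable w).map (δ - δ') = 0 :=
  toStable_map_eq_iff

/-- The shift is computed by `Ω_w⁻¹` on modules. -/
def shiftObjIso (X : Rep.{u} k G) :
    (shift w).obj ((toStable w).obj X) ≅ (toStable w).obj ((preShift w).obj X) :=
  Iso.refl _

theorem toShift_comp_shiftObjIso {Z X : Rep.{u} k G} (δ : Z ⟶ (preShift w).obj X) :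
    toShift δ ≫ (shiftObjIso X).hom = (toStable w).map δ :=
  Category.comp_id _

theorem shift_map_toStable {X Y : Rep.{u} k G} (f : X ⟶ Y) :
    (shift w).map ((toStable w).map f) = (shiftObjIso X).hom ≫ toShift ((preShift w).map f) :=
  (Category.id_comp _).symm

theorem toShift_neg {Z X : Rep.{u} k G} (δ : Z ⟶ (preShift w).obj X) :
    toShift (-δ) = -toShift δ :=
  (toStable w).map_neg (f := δ)

theorem Tri.Distinguished.exists_seq {T : Tri w} (hT : T.Distinguished) :
    ∃ (S : ShortComplex (Rep.{u} k G)) (δ : S.X₃ ⟶ (preShift w).obj S.X₁)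
      (_ : IsWSplit w S) (e : S.X₂ ⟶ (hull w).obj S.X₁)
      (_ : S.f ≫ e = (hullUnit w).app S.X₁) (_ : e ≫ (preShiftProj w).app S.X₁ = S.g ≫ δ)
      (a : T.X ≅ (toStable w).obj S.X₁) (b : T.Y ≅ (toStable w).obj S.X₂)
      (c : T.Z ≅ (toStable w).obj S.X₃),
      T.f ≫ b.hom = a.hom ≫ (toStable w).map S.f ∧
      T.g ≫ c.hom = b.hom ≫ (toStable w).map S.g ∧
      T.h ≫ (shift w).map a.hom = c.hom ≫ toShift δ := by
  obtain ⟨S, δ, hS, ⟨e, he, he'⟩, a, b, c, h⟩ := hT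
  exact ⟨S, δ, hS, e, he, he', a, b, c, h⟩

theorem distinguished_of_seq {X Y Z : StMod w} {f : X ⟶ Y} {g : Y ⟶ Z} {h : Z ⟶ (shift w).obj X}
    {S : ShortComplex (Rep.{u} k G)} {δ : S.X₃ ⟶ (preShift w).obj S.X₁} (hS : IsWSplit w S)
    (hδ : IsConnecting S δ) (a : X ≅ (toStable w).obj S.X₁) (b : Y ≅ (toStable w).obj S.X₂)
    (c : Z ≅ (toStable w).obj S.X₃) (hf : f ≫ b.hom = a.hom ≫ (toStable w).map S.f)
    (hg : g ≫ c.hom = b.hom ≫ (toStable w).map S.g)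
    (hh : h ≫ (shift w).map a.hom = c.hom ≫ toShift δ) : Tri.Distinguished ⟨f, g, h⟩ :=
  ⟨S, δ, hS, hδ, a, b, c, hf, hg, hh⟩

/-! ### Exactness properties of distinguished triangles -/

/-- The composite with `S.g` factors through a `w`-projective, and the second factor lifts along
`S.g`. Subtracting the lift leaves the stable class unchanged and makes the composite strictly zero,
so the difference factors through the kernel. -/
theorem IsWSplit.coyoneda_exact {S : ShortComplex (Rep.{u} k G)} (hS : IsWSplit w S)
    {W : StMod w} (φ : W ⟶ (toStable w).obj S.X₂) (h : φ ≫ (toStable w).map S.g = 0) :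
    ∃ ψ : W ⟶ (toStable w).obj S.X₁, ψ ≫ (toStable w).map S.f = φ := by
  obtain ⟨φ, rfl⟩ := (toStable w).map_surjective (X := W.as) φ
  rw [← Functor.map_comp] at h
  obtain ⟨P, hP, a, b, e⟩ := toStable_map_eq_zero_iff.1 h
  obtain ⟨b', rfl⟩ := hS.lift hP b
  have := hS.1.mono_f
  refine ⟨(toStable w).map (hS.1.exact.lift (φ - a ≫ b') (by simp [e])), ?_⟩
  rw [← Functor.map_comp, ShortComplex.Exact.lift_f, Functor.map_sub,
    toStable_map_comp_eq_zero hP, sub_zero]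

theorem IsWSplit.yoneda_exact {S : ShortComplex (Rep.{u} k G)} (hS : IsWSplit w S)
    {W : StMod w} (φ : (toStable w).obj S.X₂ ⟶ W) (h : (toStable w).map S.f ≫ φ = 0) :
    ∃ ψ : (toStable w).obj S.X₃ ⟶ W, (toStable w).map S.g ≫ ψ = φ := by
  obtain ⟨φ, rfl⟩ := (toStable w).map_surjective (Y := W.as) φ
  rw [← Functor.map_comp] at h
  obtain ⟨P, hP, a, b, e⟩ := toStable_map_eq_zero_iff.1 h
  obtain ⟨a', rfl⟩ := hS.extend hP a
  have := hS.1.epi_g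
  refine ⟨(toStable w).map (hS.1.exact.desc (φ - a' ≫ b) (by simp [← e])), ?_⟩
  rw [← Functor.map_comp, ShortComplex.Exact.g_desc, Functor.map_sub,
    toStable_map_comp_eq_zero hP, sub_zero]

theorem Tri.Distinguished.coyoneda_exact₂ {T : Tri w} (hT : T.Distinguished) {W : StMod w}
    (φ : W ⟶ T.Y) (h : φ ≫ T.g = 0) : ∃ ψ : W ⟶ T.X, ψ ≫ T.f = φ := by
  obtain ⟨S, δ, hS, -, a, b, c, ha, hb, -⟩ := hT
  obtain ⟨ψ, hψ⟩ := hS.coyoneda_exact (φ ≫ b.hom) (by rw [Category.assoc, ← hb, reassoc_of% h,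
    zero_comp])
  exact ⟨ψ ≫ a.inv, by
    rw [← cancel_mono b.hom, Category.assoc, Category.assoc, ha, a.inv_hom_id_assoc, hψ]⟩

theorem Tri.Distinguished.yoneda_exact₂ {T : Tri w} (hT : T.Distinguished) {W : StMod w}
    (φ : T.Y ⟶ W) (h : T.f ≫ φ = 0) : ∃ ψ : T.Z ⟶ W, T.g ≫ ψ = φ := by
  obtain ⟨S, δ, hS, -, a, b, c, ha, hb, -⟩ := hT
  have ha' : (toStable w).map S.f ≫ b.inv = a.inv ≫ T.f := by
    rw [Iso.comp_inv_eq, Category.assoc, ha, a.inv_hom_id_assoc]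
  obtain ⟨ψ, hψ⟩ := hS.yoneda_exact (b.inv ≫ φ) (by rw [reassoc_of% ha', h, comp_zero])
  exact ⟨c.hom ≫ ψ, by rw [reassoc_of% hb, hψ, b.hom_inv_id_assoc]⟩

theorem Tri.Distinguished.comp_eq_zero {T : Tri w} (hT : T.Distinguished) : T.f ≫ T.g = 0 := by
  obtain ⟨S, δ, hS, -, a, b, c, ha, hb, -⟩ := hT
  rw [← cancel_mono c.hom, Category.assoc, hb, reassoc_of% ha, ← Functor.map_comp, S.zero]
  simp

theorem Tri.Distinguished.comp_eq_zero' {T : Tri w} (hT : T.Distinguished) : T.g ≫ T.h = 0 := by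
  obtain ⟨S, δ, hS, e, he, he', a, b, c, ha, hb, hc⟩ := hT.exists_seq
  rw [← cancel_mono ((shift w).map a.hom), Category.assoc, hc, reassoc_of% hb, zero_comp,
    map_comp_toShift, ← he', toShift_eq_zero_iff.2, comp_zero]
  exact toStable_map_comp_eq_zero (isRelProjective_tensor w _) _ _

/-- The rotation `Y ⟶ Z ⟶ Ω_w⁻¹ X ⟶ Ω_w⁻¹ Y` of a triangle. -/
abbrev Tri.rotate (T : Tri w) : Tri w := ⟨T.g, T.h, -(shift w).map T.f⟩

/-! ### Rotation of triangles -/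

variable [Nontrivial w.V]

/-- The `w`-split sequence `S.X₂ ⟶ S.X₃ ⊞ hull S.X₁ ⟶ Ω_w⁻¹ S.X₁` obtained by rotating `S`. -/
abbrev rotateSeq {S : ShortComplex (Rep.{u} k G)} {δ : S.X₃ ⟶ (preShift w).obj S.X₁}
    {e : S.X₂ ⟶ (hull w).obj S.X₁} (he : e ≫ (preShiftProj w).app S.X₁ = S.g ≫ δ) :
    ShortComplex (Rep.{u} k G) :=
  ShortComplex.mk (biprod.lift S.g e) (biprod.desc δ (-(preShiftProj w).app S.X₁))
    (by rw [biprod.lift_desc, Preadditive.comp_neg, he, add_neg_cancel])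

theorem isWSplit_rotateSeq {S : ShortComplex (Rep.{u} k G)} (hS : IsWSplit w S)
    {δ : S.X₃ ⟶ (preShift w).obj S.X₁} {e : S.X₂ ⟶ (hull w).obj S.X₁}
    (he : S.f ≫ e = (hullUnit w).app S.X₁) (he' : e ≫ (preShiftProj w).app S.X₁ = S.g ≫ δ) :
    IsWSplit w (rotateSeq he') := by
  have := mono_hullUnit w S.X₁
  have := hS.1.epi_g
  have := hS.1.mono_f
  refine isWSplit_of_section
    { exact := ?_
      mono_f := ?_
      epi_g := ?_ } ?_
  · rw [ShortComplex.exact_iff_exact_up_to_refinements]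
    intro A x hx
    obtain ⟨A', π, hπ, y, hy⟩ := surjective_up_to_refinements_of_epi S.g (x ≫ biprod.fst)
    -- After lifting the first coordinate along `S.g` to `y`, the error in the second coordinate is
    -- killed by the projection, hence comes from `S.X₁`; it corrects `y` by an element of the
    -- kernel of `S.g`.
    obtain ⟨z, hz⟩ : ∃ z, z ≫ (hullUnit w).app S.X₁ = π ≫ x ≫ biprod.snd - y ≫ e := by
      refine ⟨(isWSplit_hullSeq w S.X₁).1.exact.lift (π ≫ x ≫ biprod.snd - y ≫ e) ?_,
        ShortComplex.Exact.lift_f _ _ _⟩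
      have h₁ : x ≫ biprod.fst ≫ δ - x ≫ biprod.snd ≫ (preShiftProj w).app S.X₁ = 0 := by
        rw [← hx]
        dsimp
        rw [biprod.desc_eq]
        simp [sub_eq_add_neg]
      dsimp
      rw [Preadditive.sub_comp, Category.assoc, Category.assoc, Category.assoc, he',
        ← reassoc_of% hy, ← Preadditive.comp_sub, ← neg_eq_zero, ← Preadditive.comp_neg, neg_sub]
      exact (congrArg (π ≫ ·) h₁).trans comp_zero
    refine ⟨A', π, hπ, y + z ≫ S.f, ?_⟩
    apply biprod.hom_ext
    · simpa using hy
    · simp [he, hz]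
  · refine Preadditive.mono_of_cancel_zero _ fun x hx => ?_
    have h₁ : x ≫ S.g = 0 := by simpa using congr($hx ≫ biprod.fst)
    have h₂ : x ≫ e = 0 := by simpa using congr($hx ≫ biprod.snd)
    obtain ⟨y, rfl⟩ : ∃ y, y ≫ S.f = x := ⟨hS.1.exact.lift x h₁, ShortComplex.Exact.lift_f _ _ _⟩
    rw [Category.assoc, he] at h₂
    rw [zero_of_comp_mono _ h₂, zero_comp]
  · have : Epi (biprod.inr ≫ biprod.desc δ (-(preShiftProj w).app S.X₁)) := by
      rw [biprod.inr_desc]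
      infer_instance
    exact epi_of_epi biprod.inr _
  · obtain ⟨s, hs⟩ := exists_section_preShiftProj w S.X₁
    refine ⟨-s ≫ w ◁ biprod.inr, ?_⟩
    have h := (tensorLeft w).map_neg (f := (preShiftProj w).app S.X₁)
    change w ◁ _ = - (w ◁ _) at h
    rw [Preadditive.neg_comp, Category.assoc, ← MonoidalCategory.whiskerLeft_comp,
      biprod.inr_desc, h, Preadditive.comp_neg, neg_neg, hs]

-- The unit of `S.X₂` and `e ≫ hull S.f` agree on `S.X₁`, so their difference descends to a map `κ`
-- on `S.X₃`; the ladder is `κ` together with `hull S.f`. The sign of the projection in `rotateSeq`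
-- forces the sign of the connecting map.
omit [Nontrivial w.V] in
theorem isConnecting_rotateSeq {S : ShortComplex (Rep.{u} k G)} (hS : IsWSplit w S)
    {δ : S.X₃ ⟶ (preShift w).obj S.X₁} {e : S.X₂ ⟶ (hull w).obj S.X₁}
    (he : S.f ≫ e = (hullUnit w).app S.X₁) (he' : e ≫ (preShiftProj w).app S.X₁ = S.g ≫ δ) :
    IsConnecting (w := w) (rotateSeq he') (-(preShift w).map S.f) := by
  have := hS.1.epi_g
  have h₀ : S.f ≫ (hullUnit w).app S.X₂ = (hullUnit w).app S.X₁ ≫ (hull w).map S.f :=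
    (hullUnit w).naturality S.f
  have h₁ := (preShiftProj w).naturality S.f
  let u : S.X₂ ⟶ (hull w).obj S.X₂ := (hullUnit w).app S.X₂
  obtain ⟨κ, hκ⟩ : ∃ κ, S.g ≫ κ = u - e ≫ (hull w).map S.f :=
    ⟨hS.1.exact.desc (u - e ≫ (hull w).map S.f)
      (by rw [Preadditive.comp_sub, reassoc_of% he, ← h₀]; exact sub_self _),
      ShortComplex.Exact.g_desc _ _ _⟩
  refine ⟨biprod.desc κ ((hull w).map S.f), ?_, ?_⟩
  · dsimp only
    rw [biprod.lift_desc, hκ, sub_add_cancel]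
  · dsimp only
    have hu : u ≫ (preShiftProj w).app S.X₂ = 0 := hullUnit_comp_proj w _
    apply biprod.hom_ext'
    · rw [biprod.inl_desc_assoc, biprod.inl_desc_assoc, ← cancel_epi S.g, ← Category.assoc, hκ,
        Preadditive.sub_comp, hu, Category.assoc, h₁, ← Category.assoc, he',
        Preadditive.comp_neg, Preadditive.comp_neg, zero_sub, Category.assoc]
    · rw [biprod.inr_desc_assoc, biprod.inr_desc_assoc, h₁, Preadditive.neg_comp,
        Preadditive.comp_neg, neg_neg]

/-- Adding a `w`-projective summand does not change the stable isomorphism class. -/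
def stableInlIso (X : Rep.{u} k G) {P : Rep.{u} k G} (hP : IsRelProjective w P) :
    (toStable w).obj X ≅ (toStable w).obj (X ⊞ P) where
  hom := (toStable w).map biprod.inl
  inv := (toStable w).map biprod.fst
  hom_inv_id := by rw [← Functor.map_comp, biprod.inl_fst, CategoryTheory.Functor.map_id]
  inv_hom_id := by
    rw [← Functor.map_comp, ← CategoryTheory.Functor.map_id, ← sub_eq_zero, ← Functor.map_sub,
      ← biprod.total, sub_add_cancel_left, ← Preadditive.neg_comp]
    exact toStable_map_comp_eq_zero hP _ _

/-- The rotated sequence differs from the rotated triangle only by the summand `hull S.X₁`, which is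
stably zero. -/
theorem Tri.Distinguished.rotate {T : Tri w} (hT : T.Distinguished) :
    T.rotate.Distinguished := by
  obtain ⟨S, δ, hS, e, he, he', a, b, c, ha, hb, hc⟩ := hT.exists_seq
  have hP : IsRelProjective w ((hull w).obj S.X₁) := isRelProjective_tensor w _
  refine distinguished_of_seq (isWSplit_rotateSeq hS he he') (isConnecting_rotateSeq hS he he') b
    (c ≪≫ stableInlIso _ hP) ((shift w).mapIso a ≪≫ shiftObjIso _) ?_ ?_ ?_
  · rw [Iso.trans_hom, reassoc_of% hb]
    refine congrArg (b.hom ≫ ·) ?_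
    refine ((toStable w).map_comp _ _).symm.trans (toStable_map_eq_iff.2 ?_)
    convert toStable_map_comp_eq_zero hP (-e) biprod.inr using 2
    apply biprod.hom_ext <;> simp
  · rw [Iso.trans_hom, Iso.trans_hom, Functor.mapIso_hom, reassoc_of% hc, toShift_comp_shiftObjIso,
      Category.assoc]
    refine congrArg (c.hom ≫ ·) ?_
    refine Eq.trans (congrArg (toStable w).map ?_) ((toStable w).map_comp _ _)
    exact (biprod.inl_desc _ _).symm
  · rw [Iso.trans_hom, Functor.mapIso_hom, Category.assoc, Preadditive.neg_comp,
      ← Functor.map_comp, ha, Functor.map_comp, shift_map_toStable, toShift_neg,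
      Preadditive.comp_neg, Preadditive.comp_neg]

theorem Tri.Distinguished.coyoneda_exact₃ {T : Tri w} (hT : T.Distinguished) {W : StMod w}
    (φ : W ⟶ T.Z) (h : φ ≫ T.h = 0) : ∃ ψ : W ⟶ T.Y, ψ ≫ T.g = φ :=
  hT.rotate.coyoneda_exact₂ φ h

theorem Tri.Distinguished.yoneda_exact₃ {T : Tri w} (hT : T.Distinguished) {W : StMod w}
    (φ : T.Z ⟶ W) (h : T.g ≫ φ = 0) : ∃ ψ : (shift w).obj T.X ⟶ W, T.h ≫ ψ = φ :=
  hT.rotate.yoneda_exact₂ φ h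

theorem Tri.Distinguished.coyoneda_exact₁ {T : Tri w} (hT : T.Distinguished) {W : StMod w}
    (φ : W ⟶ (shift w).obj T.X) (h : φ ≫ (shift w).map T.f = 0) :
    ∃ ψ : W ⟶ T.Z, ψ ≫ T.h = φ :=
  hT.rotate.rotate.coyoneda_exact₂ φ (by
    change φ ≫ (-(shift w).map T.f) = 0
    rw [Preadditive.comp_neg, h, neg_zero])

end

section

variable {k : Type u} [Field k] {G : Type v} [Group G]

variable {w : Rep.{u} k G} [FiniteDimensional k w.V] [Nontrivial w.V]

/-! ### Completion of morphisms and of squares -/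

/-- Adding the unit as a second coordinate, `X ⟶ Y ⊞ hull X`, does not change `f` stably but makes
it a monomorphism that splits after tensoring with `w`; its cokernel is the cone. -/
theorem exists_distinguished_seq {X Y : Rep.{u} k G} (f : X ⟶ Y) :
    ∃ (Z : StMod w) (g : (toStable w).obj Y ⟶ Z) (h : Z ⟶ (shift w).obj ((toStable w).obj X)),
      Tri.Distinguished ⟨(toStable w).map f, g, h⟩ := by
  have hP : IsRelProjective w ((hull w).obj X) := isRelProjective_tensor w _
  let i : X ⟶ Y ⊞ (hull w).obj X := biprod.lift f ((hullUnit w).app X)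
  let S := ShortComplex.mk i (cokernel.π i) (cokernel.condition i)
  have hi : i ≫ biprod.snd = (hullUnit w).app X := biprod.lift_snd _ _
  have hmono : Mono i := by
    have := mono_hullUnit w X
    have : Mono (i ≫ biprod.snd) := by rw [hi]; exact this
    exact mono_of_mono i biprod.snd
  have hS : IsWSplit w S := isWSplit_of_retraction
    { exact := ShortComplex.exact_of_g_is_cokernel _ (cokernelIsCokernel i)
      mono_f := hmono
      epi_g := inferInstanceAs (Epi (cokernel.π i)) } (by
    obtain ⟨r, hr⟩ := exists_retraction_hullUnit w X
    refine ⟨w ◁ biprod.snd ≫ r, ?_⟩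
    rw [← MonoidalCategory.whiskerLeft_comp_assoc]
    change w ◁ (i ≫ biprod.snd) ≫ r = _
    rw [hi, hr]
    rfl)
  obtain ⟨δ, hδ⟩ : ∃ δ : S.X₃ ⟶ (preShift w).obj S.X₁,
      biprod.snd ≫ (preShiftProj w).app X = S.g ≫ δ :=
    ⟨cokernel.desc i (biprod.snd ≫ (preShiftProj w).app X) (by
      rw [← Category.assoc, hi]; exact hullUnit_comp_proj w X), (cokernel.π_desc _ _ _).symm⟩
  refine ⟨(toStable w).obj S.X₃, (toStable w).map (biprod.inl ≫ S.g), toShift δ,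
    distinguished_of_seq hS ⟨biprod.snd, hi, hδ⟩ (Iso.refl _)
      (stableInlIso _ hP) (Iso.refl _) ?_ ?_ ?_⟩
  · rw [Iso.refl_hom, Category.id_comp]
    refine ((toStable w).map_comp _ _).symm.trans (toStable_map_eq_iff.2 ?_)
    have h : f ≫ biprod.inl - i = (-(hullUnit w).app X : X ⟶ _) ≫ biprod.inr := by
      apply biprod.hom_ext <;> simp [i]
    exact h ▸ toStable_map_comp_eq_zero hP _ _
  · rw [Iso.refl_hom, Category.comp_id]
    exact (toStable w).map_comp _ _
  · rw [Iso.refl_hom, Iso.refl_hom, CategoryTheory.Functor.map_id, Category.comp_id,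
      Category.id_comp]

/-- Every morphism of the relatively stable category completes to a distinguished triangle. -/
theorem exists_distinguished {X Y : StMod w} (f : X ⟶ Y) :
    ∃ (Z : StMod w) (g : Y ⟶ Z) (h : Z ⟶ (shift w).obj X), Tri.Distinguished ⟨f, g, h⟩ := by
  obtain ⟨f, rfl⟩ := (toStable w).map_surjective (X := X.as) (Y := Y.as) f
  exact exists_distinguished_seq f

omit [Nontrivial w.V] in
theorem IsWSplit.exists_distinguished {S : ShortComplex (Rep.{u} k G)} (hS : IsWSplit w S) :
    ∃ δ, Tri.Distinguished (w := w) ⟨(toStable w).map S.f, (toStable w).map S.g, toShift δ⟩ := by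
  obtain ⟨e, he⟩ : ∃ e : S.X₂ ⟶ (hull w).obj S.X₁, S.f ≫ e = (hullUnit w).app S.X₁ :=
    hS.extend (isRelProjective_tensor w _) ((hullUnit w).app S.X₁)
  have := hS.1.epi_g
  have he₀ : S.f ≫ e ≫ (preShiftProj w).app S.X₁ = 0 := by
    rw [← Category.assoc, he]
    exact hullUnit_comp_proj w _
  exact ⟨hS.1.exact.desc _ he₀,
    distinguished_of_seq hS ⟨e, he, (hS.1.exact.g_desc _ he₀).symm⟩ (Iso.refl _)
      (Iso.refl _) (Iso.refl _) (by simp) (by simp) (by simp)⟩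

-- A stably commutative square becomes strictly commutative after changing `y` by a map through a
-- `w`-projective, because the defect extends along `S.f`. Then `z` is the induced map of cokernels.
omit [Nontrivial w.V] in
theorem IsWSplit.exists_completion {S S' : ShortComplex (Rep.{u} k G)} (hS : IsWSplit w S)
    {δ : S.X₃ ⟶ (preShift w).obj S.X₁}
    {e : S.X₂ ⟶ (hull w).obj S.X₁} (he : S.f ≫ e = (hullUnit w).app S.X₁)
    (he' : e ≫ (preShiftProj w).app S.X₁ = S.g ≫ δ)
    {δ' : S'.X₃ ⟶ (preShift w).obj S'.X₁}
    {e' : S'.X₂ ⟶ (hull w).obj S'.X₁} (he₁ : S'.f ≫ e' = (hullUnit w).app S'.X₁)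
    (he₁' : e' ≫ (preShiftProj w).app S'.X₁ = S'.g ≫ δ')
    (x : (toStable w).obj S.X₁ ⟶ (toStable w).obj S'.X₁)
    (y : (toStable w).obj S.X₂ ⟶ (toStable w).obj S'.X₂)
    (h : (toStable w).map S.f ≫ y = x ≫ (toStable w).map S'.f) :
    ∃ z : (toStable w).obj S.X₃ ⟶ (toStable w).obj S'.X₃,
      (toStable w).map S.g ≫ z = y ≫ (toStable w).map S'.g ∧
      toShift δ ≫ (shift w).map x = z ≫ toShift δ' := by
  obtain ⟨x, rfl⟩ := (toStable w).map_surjective x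
  obtain ⟨y₀, rfl⟩ := (toStable w).map_surjective y
  have := hS.1.epi_g
  obtain ⟨y, hy, hxy⟩ : ∃ y : S.X₂ ⟶ S'.X₂, (toStable w).map y₀ = (toStable w).map y ∧
      S.f ≫ y = x ≫ S'.f := by
    rw [← Functor.map_comp, ← Functor.map_comp, toStable_map_eq_iff,
      toStable_map_eq_zero_iff] at h
    obtain ⟨P, hP, a, b, hab⟩ := h
    obtain ⟨a', rfl⟩ := hS.extend hP a
    refine ⟨y₀ - a' ≫ b, ?_, ?_⟩
    · rw [toStable_map_eq_iff, sub_sub_cancel]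
      exact toStable_map_comp_eq_zero hP _ _
    · rw [Category.assoc] at hab
      rw [Preadditive.comp_sub, hab, sub_sub_cancel]
  obtain ⟨z, hz⟩ : ∃ z, S.g ≫ z = y ≫ S'.g :=
    ⟨hS.1.exact.desc (y ≫ S'.g) (by rw [reassoc_of% hxy, S'.zero, comp_zero]),
      ShortComplex.Exact.g_desc _ _ _⟩
  refine ⟨(toStable w).map z, ?_, ?_⟩
  · rw [hy, ← Functor.map_comp, hz, Functor.map_comp]
  · rw [toShift_comp_shift_map, map_comp_toShift, toShift_eq_iff]
    have h₀ : x ≫ (hullUnit w).app S'.X₁ = (hullUnit w).app S.X₁ ≫ (hull w).map x :=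
      (hullUnit w).naturality x
    have h₁ := (preShiftProj w).naturality x
    -- The two resulting maps `S.X₂ ⟶ hull S'.X₁` agree on `S.X₁`; their difference descends to `κ`,
    -- through which the difference of the connecting maps factors.
    have h₂ : S.f ≫ (e ≫ (hull w).map x - y ≫ e') = 0 := by
      rw [Preadditive.comp_sub, reassoc_of% he, reassoc_of% hxy, he₁, h₀, sub_self]
    obtain ⟨κ, hκ⟩ : ∃ κ, S.g ≫ κ = e ≫ (hull w).map x - y ≫ e' :=
      ⟨hS.1.exact.desc _ h₂, hS.1.exact.g_desc _ h₂⟩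
    have h₄ : δ ≫ (preShift w).map x - z ≫ δ' = κ ≫ (preShiftProj w).app S'.X₁ := by
      rw [← cancel_epi S.g, ← Category.assoc _ κ, hκ, Preadditive.comp_sub, Preadditive.sub_comp,
        Category.assoc, Category.assoc, h₁, reassoc_of% he', he₁', reassoc_of% hz]
    rw [h₄]
    exact toStable_map_comp_eq_zero (isRelProjective_tensor w _) _ _

omit [Nontrivial w.V] in
theorem Tri.Distinguished.exists_completion {T T' : Tri w} (hT : T.Distinguished)
    (hT' : T'.Distinguished) (x : T.X ⟶ T'.X) (y : T.Y ⟶ T'.Y) (h : T.f ≫ y = x ≫ T'.f) :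
    ∃ z : T.Z ⟶ T'.Z, T.g ≫ z = y ≫ T'.g ∧ T.h ≫ (shift w).map x = z ≫ T'.h := by
  obtain ⟨S, δ, hS, e, he, he', a, b, c, ha, hb, hc⟩ := hT.exists_seq
  obtain ⟨S', δ', hS', e', he₁, he₁', a', b', c', ha', hb', hc'⟩ := hT'.exists_seq
  obtain ⟨z, hz, hz'⟩ := hS.exists_completion he he' he₁ he₁' (a.inv ≫ x ≫ a'.hom)
    (b.inv ≫ y ≫ b'.hom) (by
      rw [← cancel_epi a.hom, ← reassoc_of% ha]
      simp only [Iso.hom_inv_id_assoc, Category.assoc]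
      rw [reassoc_of% h, ha'])
  refine ⟨c.hom ≫ z ≫ c'.inv, ?_, ?_⟩
  · rw [reassoc_of% hb, reassoc_of% hz, ← reassoc_of% hb', c'.hom_inv_id, Category.comp_id,
      b.hom_inv_id_assoc]
  · rw [← cancel_mono ((shift w).map a'.hom), Category.assoc, Category.assoc, Category.assoc, Category.assoc, hc',
      c'.inv_hom_id_assoc, ← hz', ← reassoc_of% hc, ← Functor.map_comp, ← Functor.map_comp,
      a.hom_inv_id_assoc]

/-- The five lemma for morphisms of distinguished triangles. -/
theorem Tri.Distinguished.isIso_of_isIso {T T' : Tri w} (hT : T.Distinguished)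
    (hT' : T'.Distinguished) (x : T.X ⟶ T'.X) (y : T.Y ⟶ T'.Y) (z : T.Z ⟶ T'.Z)
    (hx : T.f ≫ y = x ≫ T'.f) (hy : T.g ≫ z = y ≫ T'.g) (hz : T.h ≫ (shift w).map x = z ≫ T'.h)
    (_ : IsIso x) (_ : IsIso y) : IsIso z := by
  have : Mono z := by
    refine Preadditive.mono_of_cancel_zero _ fun {W} φ hφ => ?_
    have h₁ : φ ≫ T.h = 0 := by
      rw [← cancel_mono ((shift w).map x), Category.assoc, hz, reassoc_of% hφ, zero_comp, zero_comp]
    obtain ⟨φ', rfl⟩ := hT.coyoneda_exact₃ φ h₁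
    rw [Category.assoc, hy, ← Category.assoc] at hφ
    obtain ⟨φ'', hφ''⟩ := hT'.coyoneda_exact₂ _ hφ
    have h₂ : φ' = (φ'' ≫ inv x) ≫ T.f := by
      rw [← cancel_mono y, Category.assoc, Category.assoc, hx, IsIso.inv_hom_id_assoc, hφ'']
    rw [h₂, Category.assoc, hT.comp_eq_zero, comp_zero]
  have hx' : (inv x) ≫ T.f = T'.f ≫ inv y := by
    rw [IsIso.inv_comp_eq, ← Category.assoc, ← hx, Category.assoc, IsIso.hom_inv_id,
      Category.comp_id]
  -- Construction of a section of `z`: `θ` is right after composing with `T'.h`, so `θ ≫ z` misses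
  -- the identity by a map through `T'.g`, which is pulled back along the isomorphism `y`.
  obtain ⟨θ, hθ⟩ := hT.coyoneda_exact₁ (T'.h ≫ (shift w).map (inv x)) (by
    have h₁ := hT'.rotate.comp_eq_zero'
    have h₂ : T'.h ≫ (shift w).map T'.f = 0 := by
      rw [← neg_eq_zero, ← Preadditive.comp_neg]
      exact h₁
    rw [Category.assoc, ← Functor.map_comp, hx', Functor.map_comp, reassoc_of% h₂, zero_comp])
  obtain ⟨κ, hκ⟩ := hT'.coyoneda_exact₃ (θ ≫ z - 𝟙 _) (by
    rw [Preadditive.sub_comp, Category.assoc, ← hz, reassoc_of% hθ, ← Functor.map_comp,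
      IsIso.inv_hom_id, CategoryTheory.Functor.map_id, Category.comp_id, Category.id_comp, sub_self])
  have hs : (θ - κ ≫ inv y ≫ T.g) ≫ z = 𝟙 _ := by
    rw [Preadditive.sub_comp, Category.assoc, Category.assoc, hy, IsIso.inv_hom_id_assoc, hκ,
      sub_sub_cancel]
  have : IsSplitEpi z := ⟨⟨⟨_, hs⟩⟩⟩
  exact isIso_of_mono_of_isSplitEpi z

/-! ### The shift is an equivalence -/

omit [Nontrivial w.V] in
instance shift_additive : (shift w).Additive where
  map_add {X Y f g} := by
    obtain ⟨f, rfl⟩ := (toStable w).map_surjective (X := X.as) (Y := Y.as) f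
    obtain ⟨g, rfl⟩ := (toStable w).map_surjective (X := X.as) (Y := Y.as) g
    exact (congrArg (toStable w).map ((preShift w).map_add (f := f) (g := g))).trans
      ((toStable w).map_add)

/-- If `Ω_w⁻¹ φ` factors through a `w`-projective, lift its second factor to the hull of `Y`.
Subtracting the lifted map from `hull φ` leaves a map into the kernel `Y`, and this map extends `φ`
to the hull of `X`. -/
instance shift_faithful : (shift w).Faithful where
  map_injective {X Y f g} h := by
    obtain ⟨f, rfl⟩ := (toStable w).map_surjective (X := X.as) (Y := Y.as) f
    obtain ⟨g, rfl⟩ := (toStable w).map_surjective (X := X.as) (Y := Y.as) g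
    have h' : (toStable w).map ((preShift w).map f) = (toStable w).map ((preShift w).map g) := h
    rw [toStable_map_eq_iff, ← Functor.map_sub, toStable_map_eq_zero_iff] at h'
    refine toStable_map_eq_iff.2 ?_
    generalize f - g = φ at h'
    obtain ⟨P, hP, a, b, hab⟩ := h'
    obtain ⟨b', hb' : b' ≫ (preShiftProj w).app Y.as = b⟩ := (isWSplit_hullSeq w Y.as).lift hP b
    have h₀ : φ ≫ (hullUnit w).app Y.as = (hullUnit w).app X.as ≫ (hull w).map φ :=
      (hullUnit w).naturality φ
    have := mono_hullUnit w Y.as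
    have hφ : ((hull w).map φ - (preShiftProj w).app X.as ≫ a ≫ b') ≫
        (preShiftProj w).app Y.as = 0 := by
      rw [Preadditive.sub_comp, Category.assoc, Category.assoc, hb', hab,
        (preShiftProj w).naturality, sub_self]
    obtain ⟨ρ, hρ⟩ : ∃ ρ : (hull w).obj X.as ⟶ Y.as, ρ ≫ (hullUnit w).app Y.as =
        (hull w).map φ - (preShiftProj w).app X.as ≫ a ≫ b' :=
      ⟨(isWSplit_hullSeq w Y.as).1.exact.lift _ hφ, ShortComplex.Exact.lift_f _ _ _⟩
    have : (hullUnit w).app X.as ≫ ρ = φ := by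
      rw [← cancel_mono ((hullUnit w).app Y.as), Category.assoc, hρ, Preadditive.comp_sub,
        ← Category.assoc _ ((preShiftProj w).app X.as), hullUnit_comp_proj, zero_comp, sub_zero]
      exact h₀.symm
    rw [← this]
    exact toStable_map_comp_eq_zero (isRelProjective_tensor w _) _ _

/-- Relative projectivity lifts `ψ` to a map `θ` of hulls, which restricts to `φ` on kernels. As
`hull φ` and `θ` agree on `X`, the maps `Ω_w⁻¹ φ` and `ψ` differ by a map through a hull. -/
instance shift_full : (shift w).Full where
  map_surjective {X Y} ψ := by
    obtain ⟨ψ, rfl⟩ := (toStable w).map_surjective (X := (preShift w).obj X.as)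
      (Y := (preShift w).obj Y.as) ψ
    have := mono_hullUnit w Y.as
    obtain ⟨θ, hθ⟩ : ∃ θ : (hull w).obj X.as ⟶ (hull w).obj Y.as,
        θ ≫ (preShiftProj w).app Y.as = (preShiftProj w).app X.as ≫ ψ :=
      (isWSplit_hullSeq w Y.as).lift (isRelProjective_tensor w _) ((preShiftProj w).app X.as ≫ ψ)
    have h₁ : ((hullUnit w).app X.as ≫ θ) ≫ (preShiftProj w).app Y.as = 0 := by
      rw [Category.assoc, hθ, ← Category.assoc, hullUnit_comp_proj, zero_comp]
    obtain ⟨φ, hφ⟩ : ∃ φ : X.as ⟶ Y.as, φ ≫ (hullUnit w).app Y.as = (hullUnit w).app X.as ≫ θ :=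
      ⟨(isWSplit_hullSeq w Y.as).1.exact.lift _ h₁, ShortComplex.Exact.lift_f _ _ _⟩
    have h₀ : φ ≫ (hullUnit w).app Y.as = (hullUnit w).app X.as ≫ (hull w).map φ :=
      (hullUnit w).naturality φ
    have h₂ : (hullUnit w).app X.as ≫ ((hull w).map φ - θ) = 0 := by
      rw [Preadditive.comp_sub, ← hφ, ← h₀]
      exact sub_self _
    have := (isWSplit_hullSeq w X.as).1.epi_g
    obtain ⟨κ, hκ⟩ : ∃ κ : (preShift w).obj X.as ⟶ (hull w).obj Y.as,
        (preShiftProj w).app X.as ≫ κ = (hull w).map φ - θ :=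
      ⟨(isWSplit_hullSeq w X.as).1.exact.desc _ h₂,
        (isWSplit_hullSeq w X.as).1.exact.g_desc _ h₂⟩
    refine ⟨(toStable w).map φ, ?_⟩
    change (toStable w).map ((preShift w).map φ) = _
    rw [toStable_map_eq_iff]
    have h₄ : (preShift w).map φ - ψ =
        κ ≫ (preShiftProj w).app Y.as := by
      rw [← cancel_epi ((preShiftProj w).app X.as), ← Category.assoc _ κ, hκ, Preadditive.sub_comp, hθ,
        Preadditive.comp_sub, (preShiftProj w).naturality]
    rw [h₄]
    exact toStable_map_comp_eq_zero (isRelProjective_tensor w _) _ _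

/-- A triangle whose second object vanishes identifies the third with the shift of the first. -/
theorem Tri.Distinguished.isIso_of_isZero {T : Tri w} (hT : T.Distinguished) (h : IsZero T.Y) :
    IsIso T.h := by
  have : Mono T.h := Preadditive.mono_of_cancel_zero _ fun φ hφ => by
    obtain ⟨ψ, rfl⟩ := hT.coyoneda_exact₃ φ hφ
    rw [h.eq_zero_of_src T.g, comp_zero]
  obtain ⟨s, hs⟩ := hT.coyoneda_exact₁ (𝟙 _) (by
    rw [h.eq_zero_of_tgt T.f, Functor.map_zero, comp_zero])
  have : IsSplitEpi T.h := ⟨⟨⟨s, hs⟩⟩⟩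
  exact isIso_of_mono_of_isSplitEpi _

/-- The kernel `Ω_w X` of the canonical map `w^* ⊗ (w ⊗ X) ⟶ X`. -/
abbrev syzygy (w : Rep.{u} k G) [FiniteDimensional k w.V] (X : Rep.{u} k G) : Rep.{u} k G :=
  kernel (coverMap w X)

theorem nonempty_iso_shift_syzygy (X : Rep.{u} k G) :
    Nonempty ((toStable w).obj X ≅ (shift w).obj ((toStable w).obj (syzygy w X))) := by
  obtain ⟨δ, hδ⟩ := (isWSplit_coverSeq w X).exists_distinguished
  have := hδ.isIso_of_isZero (isZero_toStable_obj (isRelProjective_cover w X))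
  exact ⟨asIso (toShift δ)⟩

instance shift_essSurj : (shift w).EssSurj where
  mem_essImage X := ⟨_, ⟨(nonempty_iso_shift_syzygy X.as).some.symm⟩⟩

end

section

variable {k : Type u} [Field k] {G : Type v} [Group G]

/-! ### Finite-dimensional modules are compact -/

instance (J : Type) [SmallCategory J] (F : J ⥤ Rep.{u} k G) :
    PreservesColimit F (forget₂ (Rep.{u} k G) (ModuleCat.{u} k)) :=
  have : PreservesColimitsOfSize.{0, 0} (forget₂ (Rep.{u} k G) (ModuleCat.{u} k)) :=
    preservesColimitsOfSize_shrink.{0, u, 0, u} _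
  inferInstance

instance : PreservesFilteredColimitsOfSize.{0, 0} (forget (ModuleCat.{u} k)) :=
  preservesSmallestFilteredColimits_of_preservesFilteredColimits _

section

variable {m : ℕ ⥤ Rep.{u} k G} {c : Cocone m}

theorem exists_ι_apply_eq (hc : IsColimit c) (x : c.pt.V) :
    ∃ (i : ℕ) (y : (m.obj i).V), (c.ι.app i).hom y = x := by
  have h := Concrete.isColimit_exists_rep (m ⋙ forget₂ (Rep.{u} k G) (ModuleCat.{u} k))
    (isColimitOfPreserves (forget₂ (Rep.{u} k G) (ModuleCat.{u} k)) hc)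
  exact h x

theorem exists_map_apply_eq_zero (hc : IsColimit c) {i : ℕ} (y : (m.obj i).V)
    (h : (c.ι.app i).hom y = 0) : ∃ (j : ℕ) (hij : i ≤ j), (m.map (homOfLE hij)).hom y = 0 := by
  have h' : (c.ι.app i).hom y = (c.ι.app i).hom 0 := by rw [h, map_zero]
  obtain ⟨j, f, g, e⟩ := Concrete.isColimit_exists_of_rep_eq
    (m ⋙ forget₂ (Rep.{u} k G) (ModuleCat.{u} k))
    (isColimitOfPreserves (forget₂ (Rep.{u} k G) (ModuleCat.{u} k)) hc) y 0 h'
  exact ⟨j, leOfHom f, e.trans (map_zero (m.map g).hom)⟩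

end

theorem finiteDimensional_of_mono {X Y : Rep.{u} k G} (f : X ⟶ Y) [Mono f]
    [FiniteDimensional k Y.V] : FiniteDimensional k X.V :=
  FiniteDimensional.of_injective f.hom.toLinearMap ((Rep.mono_iff_injective f).1 inferInstance)

theorem finiteDimensional_of_epi {X Y : Rep.{u} k G} (f : X ⟶ Y) [Epi f]
    [FiniteDimensional k X.V] : FiniteDimensional k Y.V :=
  Module.Finite.of_surjective f.hom.toLinearMap ((Rep.epi_iff_surjective f).1 inferInstance)

instance (X Y : Rep.{u} k G) [FiniteDimensional k X.V] [FiniteDimensional k Y.V] :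
    FiniteDimensional k (X ⊗ Y).V :=
  inferInstanceAs (FiniteDimensional k (TensorProduct k X.V Y.V))

section

variable {m : ℕ ⥤ Rep.{u} k G} {c : Cocone m}

theorem map_comp_ι {i j : ℕ} (h : i ≤ j) : m.map (homOfLE h) ≫ c.ι.app j = c.ι.app i := by
  simp

/-- A finite family of elements of stage `i` that vanish in the colimit vanishes at some later
stage. -/
theorem exists_map_apply_eq_zero_of_finite (hc : IsColimit c) {α : Type*} [Finite α] {i : ℕ}
    (y : α → (m.obj i).V) (h : ∀ a, (c.ι.app i).hom (y a) = 0) :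
    ∃ (j : ℕ) (hij : i ≤ j), ∀ a, (m.map (homOfLE hij)).hom (y a) = 0 := by
  choose j hij hj using fun a => exists_map_apply_eq_zero hc (y a) (h a)
  cases nonempty_fintype α
  refine ⟨i ⊔ Finset.univ.sup j, le_sup_left, fun a => ?_⟩
  have ha : j a ≤ i ⊔ Finset.univ.sup j := le_sup_of_le_right (Finset.le_sup (Finset.mem_univ a))
  have : m.map (homOfLE (le_sup_left : i ≤ i ⊔ Finset.univ.sup j)) =
      m.map (homOfLE (hij a)) ≫ m.map (homOfLE ha) := by
    rw [← m.map_comp]; rfl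
  rw [this, Rep.hom_comp, Representation.IntertwiningMap.comp_apply, hj, map_zero]

/-- A map from a finite-dimensional module that vanishes in the colimit vanishes at some later
stage. -/
theorem exists_comp_map_eq_zero (hc : IsColimit c) {X : Rep.{u} k G} [FiniteDimensional k X.V]
    {i : ℕ} (f : X ⟶ m.obj i) (h : f ≫ c.ι.app i = 0) :
    ∃ (j : ℕ) (hij : i ≤ j), f ≫ m.map (homOfLE hij) = 0 := by
  let b := Module.finBasis k X.V
  obtain ⟨j, hij, hj⟩ := exists_map_apply_eq_zero_of_finite hc (fun a => f.hom (b a))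
    (fun a => congr(($h).hom (b a)))
  refine ⟨j, hij, ?_⟩
  ext1
  apply Representation.IntertwiningMap.toLinearMap_injective
  exact b.ext hj

/-- A map from a finite-dimensional module to the colimit factors through some stage. -/
theorem exists_comp_ι_eq [Finite G] (hc : IsColimit c) {X : Rep.{u} k G} [FiniteDimensional k X.V]
    (f : X ⟶ c.pt) : ∃ (i : ℕ) (g : X ⟶ m.obj i), g ≫ c.ι.app i = f := by
  let b := Module.finBasis k X.V
  choose i y hy using fun a => exists_ι_apply_eq hc (f.hom (b a))
  let n := Finset.univ.sup i
  have hn : ∀ a, i a ≤ n := fun a => Finset.le_sup (Finset.mem_univ a)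
  let g : X.V →ₗ[k] (m.obj n).V := b.constr k fun a => (m.map (homOfLE (hn a))).hom (y a)
  have hg : (c.ι.app n).hom.toLinearMap ∘ₗ g = f.hom.toLinearMap := by
    refine b.ext fun a => ?_
    rw [LinearMap.comp_apply, Module.Basis.constr_basis]
    refine Eq.trans ?_ (hy a)
    rw [← map_comp_ι (c := c) (hn a)]
    rfl
  have hg' : ∀ x, (c.ι.app n).hom (g x) = f.hom x := fun x => LinearMap.congr_fun hg x
  -- So far `g` is only linear. Its failure to be equivariant is measured by finitely many elements,
  -- since `G` is finite, and these vanish in the colimit, hence at a later stage.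
  obtain ⟨j, hj, h⟩ := exists_map_apply_eq_zero_of_finite hc
    (fun p : G × Fin (Module.finrank k X.V) => g (X.ρ p.1 (b p.2)) - (m.obj n).ρ p.1 (g (b p.2)))
    (fun p => by
      rw [map_sub, Rep.hom_comm_apply, hg', hg', Rep.hom_comm_apply]
      exact sub_self _)
  refine ⟨j, Rep.ofHom ⟨(m.map (homOfLE hj)).hom.toLinearMap ∘ₗ g, fun s => b.ext fun a => ?_⟩, ?_⟩
  · have := h (s, a)
    rw [map_sub, sub_eq_zero, Rep.hom_comm_apply] at this
    exact this
  · ext x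
    have : (c.ι.app j).hom ((m.map (homOfLE hj)).hom (g x)) = f.hom x := by
      rw [← hg', ← map_comp_ι (c := c) hj]
      rfl
    exact this

end

/-! ### Direct sums of modules and their finite partial sums -/

section

variable {X : ℕ → Rep.{u} k G}

theorem Sigma.ι_comp_sum_π {i n : ℕ} (h : i < n) :
    Sigma.ι X i ≫ (∑ j ∈ Finset.range n, Sigma.π X j ≫ Sigma.ι X j) = Sigma.ι X i := by
  rw [Preadditive.comp_sum, Finset.sum_eq_single i]
  · rw [Sigma.ι_π_eq_id_assoc]
  · intro j _ hj
    rw [Sigma.ι_π_of_ne_assoc _ hj.symm, zero_comp]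
  · intro hi
    exact absurd (Finset.mem_range.2 h) hi

/-- The elements fixed by all large partial projections form a submodule `N` that contains every
summand. The quotient map by `N` therefore vanishes on each summand, hence is zero. -/
theorem exists_sum_π_apply_eq (y : (∐ X).V) : ∃ n, ∀ n', n ≤ n' →
    (∑ j ∈ Finset.range n', Sigma.π X j ≫ Sigma.ι X j).hom y = y := by
  let N : Submodule k (∐ X).V :=
    { carrier := {y | ∃ n, ∀ n', n ≤ n' →
        (∑ j ∈ Finset.range n', Sigma.π X j ≫ Sigma.ι X j).hom y = y}
      zero_mem' := ⟨0, fun n' _ => map_zero _⟩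
      add_mem' := by
        rintro a b ⟨n₁, h₁⟩ ⟨n₂, h₂⟩
        exact ⟨max n₁ n₂, fun n' hn => by
          rw [map_add, h₁ n' (le_of_max_le_left hn), h₂ n' (le_of_max_le_right hn)]⟩
      smul_mem' := by
        rintro r a ⟨n, h⟩
        exact ⟨n, fun n' hn => by rw [map_smul, h n' hn]⟩ }
  have hN : ∀ g, N ≤ N.comap ((∐ X).ρ g) := by
    rintro g a ⟨n, h⟩
    exact ⟨n, fun n' hn => by rw [Rep.hom_comm_apply, h n' hn]⟩
  have h₀ : Rep.mkQ (∐ X) N hN = 0 := by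
    apply Sigma.hom_ext
    intro i
    rw [comp_zero]
    ext x
    refine (Submodule.Quotient.mk_eq_zero N).2 ⟨i + 1, fun n' hn => ?_⟩
    exact congr(($(Sigma.ι_comp_sum_π (X := X) (Nat.lt_of_succ_le hn))).hom x)
  have h₁ : N.mkQ y = 0 := congr(($h₀).hom y)
  exact (Submodule.Quotient.mk_eq_zero N).1 h₁

/-- A map from a finite-dimensional module to a direct sum lands in a finite partial sum. -/
theorem exists_eq_sum_comp_π {Y : Rep.{u} k G} [FiniteDimensional k Y.V] (f : Y ⟶ ∐ X) :
    ∃ n, f = ∑ j ∈ Finset.range n, (f ≫ Sigma.π X j) ≫ Sigma.ι X j := by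
  let b := Module.finBasis k Y.V
  choose n hn using fun a => exists_sum_π_apply_eq (f.hom (b a))
  refine ⟨Finset.univ.sup n, ?_⟩
  simp_rw [Category.assoc]
  rw [← Preadditive.comp_sum]
  ext1
  apply Representation.IntertwiningMap.toLinearMap_injective
  exact b.ext fun a => (hn a _ (Finset.le_sup (Finset.mem_univ a))).symm

end

/-! ### The map `1 - s` in coordinates -/

section

variable (m : ℕ ⥤ Rep.{u} k G)

theorem ι_comp_oneSubShift (i : ℕ) :
    Sigma.ι (fun i => m.obj i) i ≫ oneSubShift m = Sigma.ι (fun i => m.obj i) i -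
      m.map (homOfLE (Nat.le_succ i)) ≫ Sigma.ι (fun i => m.obj i) (i + 1) :=
  Sigma.ι_desc _ _

theorem ι_comp_sumMap {m : ℕ ⥤ Rep.{u} k G} (c : Cocone m) (i : ℕ) :
    Sigma.ι (fun i => m.obj i) i ≫ sumMap c = c.ι.app i :=
  Sigma.ι_desc _ _

theorem oneSubShift_comp_sumMap {m : ℕ ⥤ Rep.{u} k G} (c : Cocone m) :
    oneSubShift m ≫ sumMap c = 0 := by
  apply Sigma.hom_ext
  intro i
  rw [← Category.assoc, ι_comp_oneSubShift, Preadditive.sub_comp, Category.assoc, ι_comp_sumMap,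
    ι_comp_sumMap, map_comp_ι, sub_self, comp_zero]

theorem oneSubShift_comp_π_zero :
    oneSubShift m ≫ Sigma.π (fun i => m.obj i) 0 = Sigma.π (fun i => m.obj i) 0 := by
  apply Sigma.hom_ext
  intro i
  rw [← Category.assoc, ι_comp_oneSubShift, Preadditive.sub_comp, Category.assoc,
    Sigma.ι_π_of_ne _ (Nat.succ_ne_zero i), comp_zero, sub_zero]

theorem oneSubShift_comp_π_succ (j : ℕ) :
    oneSubShift m ≫ Sigma.π (fun i => m.obj i) (j + 1) = Sigma.π (fun i => m.obj i) (j + 1) -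
      Sigma.π (fun i => m.obj i) j ≫ m.map (homOfLE (Nat.le_succ j)) := by
  apply Sigma.hom_ext
  intro i
  rw [← Category.assoc, ι_comp_oneSubShift, Preadditive.sub_comp, Category.assoc,
    Preadditive.comp_sub]
  congr 1
  by_cases h : i = j
  · subst h
    rw [Sigma.ι_π_eq_id, Sigma.ι_π_eq_id_assoc, Category.comp_id]
  · rw [Sigma.ι_π_of_ne _ (by simpa using h), Sigma.ι_π_of_ne_assoc _ h, comp_zero, zero_comp]

end

/-! ### Direct sums in the relatively stable category -/

section

variable {w : Rep.{u} k G} [FiniteDimensional k w.V] [Nontrivial w.V] {ι : Type*}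
  (X : ι → Rep.{u} k G) [HasCoproduct X]

/-- All components of the difference factor through the same cover of the target, so their
factorizations assemble to one on the direct sum. -/
theorem toStable_sigma_hom_ext {Y : StMod w} {f g : (toStable w).obj (∐ X) ⟶ Y}
    (h : ∀ i, (toStable w).map (Sigma.ι X i) ≫ f = (toStable w).map (Sigma.ι X i) ≫ g) :
    f = g := by
  obtain ⟨f, rfl⟩ := (toStable w).map_surjective (Y := Y.as) f
  obtain ⟨g, rfl⟩ := (toStable w).map_surjective (Y := Y.as) g
  rw [toStable_map_eq_iff]
  have h' : ∀ i, (toStable w).map (Sigma.ι X i ≫ (f - g)) = 0 := fun i => by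
    rw [Preadditive.comp_sub, ← toStable_map_eq_iff, Functor.map_comp, Functor.map_comp]
    exact h i
  choose a ha using fun i => exists_comp_coverMap_eq (h' i)
  have : f - g = Sigma.desc a ≫ coverMap w Y.as := by
    apply Sigma.hom_ext
    intro i
    rw [Sigma.ι_desc_assoc, ha]
  rw [this]
  exact toStable_map_comp_eq_zero (isRelProjective_cover w _) _ _

omit [FiniteDimensional k w.V] [Nontrivial w.V] in
theorem exists_toStable_sigma_desc {Y : StMod w} (f : ∀ i, (toStable w).obj (X i) ⟶ Y) :
    ∃ g : (toStable w).obj (∐ X) ⟶ Y, ∀ i, (toStable w).map (Sigma.ι X i) ≫ g = f i := by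
  choose g hg using fun i => (toStable w).map_surjective (Y := Y.as) (f i)
  exact ⟨(toStable w).map (Sigma.desc g), fun i => by
    rw [← hg, ← Sigma.ι_desc g i, Functor.map_comp]⟩

/-- The direct sum of modules is a coproduct in the relatively stable category. -/
def isColimitToStableSigma :
    IsColimit (Cofan.mk ((toStable w).obj (∐ X))
      fun i : ULift.{u} ι => (toStable w).map (Sigma.ι X i.down)) :=
  Cofan.IsColimit.mk _
    (fun t => (exists_toStable_sigma_desc X fun i => t.inj ⟨i⟩).choose)
    (fun t j => (exists_toStable_sigma_desc X fun i => t.inj ⟨i⟩).choose_spec j.down)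
    (fun t _ hf => toStable_sigma_hom_ext X fun i => (hf ⟨i⟩).trans
      ((exists_toStable_sigma_desc X fun i => t.inj ⟨i⟩).choose_spec i).symm)

end

end

section

variable {k : Type u} [Field k] {G : Type v} [Group G]

variable {w : Rep.{u} k G} [FiniteDimensional k w.V]

/-! ### The localizing subcategory generated by the finite-dimensional modules -/

theorem isLocalizing_locFD : IsLocalizing (locFD w) where
  shift_iff X := ⟨fun h P hP hx => (hP.shift_iff X).1 (h P hP hx),
    fun h P hP hx => (hP.shift_iff X).2 (h P hP hx)⟩
  cone T hT h h' P hP hx := hP.cone T hT (h P hP hx) (h' P hP hx)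
  retract X Y r h P hP hx := hP.retract X Y r (h P hP hx)
  coproduct ι X c hc h P hP hx := hP.coproduct ι X c hc fun i => h i P hP hx

theorem locFD_toStable (x : Rep.{u} k G) [FiniteDimensional k x.V] :
    locFD w ((toStable w).obj x) :=
  fun _ _ hx => hx x inferInstance

instance : FiniteDimensional k (dual w).V :=
  inferInstanceAs (FiniteDimensional k (Module.Dual k w.V))

instance (x : Rep.{u} k G) [FiniteDimensional k x.V] : FiniteDimensional k ((hull w).obj x).V :=
  inferInstanceAs (FiniteDimensional k (w ⊗ (dual w ⊗ x)).V)

variable [Nontrivial w.V]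

theorem Tri.Distinguished.comp_shift_map_eq_zero {T : Tri w} (hT : T.Distinguished) :
    T.h ≫ (shift w).map T.f = 0 := by
  rw [← neg_eq_zero, ← Preadditive.comp_neg]
  exact hT.rotate.comp_eq_zero'

variable (w) in
/-- The objects that receive no nonzero morphism from a finite-dimensional module. -/
def fdLocal : ObjectProperty (StMod w) := fun N =>
  ∀ (x : Rep.{u} k G) [FiniteDimensional k x.V] (φ : (toStable w).obj x ⟶ N), φ = 0

theorem hom_shift_eq_zero {X N : StMod w} (h : ∀ φ : X ⟶ N, φ = 0)
    (φ : (shift w).obj X ⟶ (shift w).obj N) : φ = 0 := by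
  obtain ⟨φ, rfl⟩ := (shift w).map_surjective φ
  rw [h φ, Functor.map_zero]

/-- Both `Ω_w⁻¹` and `Ω_w` preserve finite-dimensionality. -/
theorem fdLocal_shift_iff {N : StMod w} : fdLocal w ((shift w).obj N) ↔ fdLocal w N := by
  constructor
  · intro h x _ φ
    apply (shift w).map_injective
    rw [Functor.map_zero]
    have : FiniteDimensional k ((preShift w).obj x).V :=
      finiteDimensional_of_epi ((preShiftProj w).app x)
    exact h ((preShift w).obj x) _
  · intro h x _ φ
    obtain ⟨i⟩ := nonempty_iso_shift_syzygy (w := w) x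
    have : FiniteDimensional k (syzygy w x).V := finiteDimensional_of_mono (kernel.ι _)
    rw [← cancel_epi i.inv, comp_zero]
    exact hom_shift_eq_zero (h (syzygy w x)) _

-- Closure under the shift and its inverse holds because the class of targets is itself closed under
-- both. Closure under cones is the exact sequence: a map on the cone that dies on `T.Y` comes from
-- the shift of `T.X`.
variable (w) in
theorem isLocalizing_leftOrthogonal_fdLocal :
    IsLocalizing (w := w) fun X => ∀ N, fdLocal w N → ∀ φ : X ⟶ N, φ = 0 where
  shift_iff X := by
    constructor
    · intro h N hN φ
      apply (shift w).map_injective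
      rw [Functor.map_zero]
      exact h _ (fdLocal_shift_iff.2 hN) _
    · intro h N hN φ
      let i := (shift w).objObjPreimageIso N
      have hN' : fdLocal w ((shift w).objPreimage N) := by
        rw [← fdLocal_shift_iff]
        intro x _ ψ
        rw [← cancel_mono i.hom, zero_comp]
        exact hN x _
      rw [← cancel_mono i.inv, zero_comp]
      exact hom_shift_eq_zero (h _ hN') _
  cone T hT hX hY N hN φ := by
    obtain ⟨ψ, rfl⟩ := hT.yoneda_exact₃ φ (hY N hN _)
    let i := (shift w).objObjPreimageIso N
    have hN' : fdLocal w ((shift w).objPreimage N) := by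
      rw [← fdLocal_shift_iff]
      intro x _ ψ
      rw [← cancel_mono i.hom, zero_comp]
      exact hN x _
    have : ψ ≫ i.inv = 0 := hom_shift_eq_zero (hX _ hN') _
    rw [← cancel_mono i.inv, Category.assoc, this, comp_zero, zero_comp]
  retract X Y r h N hN φ := by
    rw [← Category.id_comp φ, ← r.retract, Category.assoc, h N hN (r.r ≫ φ), comp_zero]
  coproduct ι X c hc h N hN φ := by
    refine Cofan.IsColimit.hom_ext hc _ _ fun i => ?_
    rw [h i N hN (c.inj i ≫ φ), comp_zero]

/-- An object without nonzero morphisms from finite-dimensional modules is local for the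
localizing subcategory that they generate. -/
theorem eq_zero_of_locFD {X N : StMod w} (hX : locFD w X) (hN : fdLocal w N) (φ : X ⟶ N) :
    φ = 0 :=
  hX _ (isLocalizing_leftOrthogonal_fdLocal w) (fun x _ _ hN φ => hN x φ) N hN φ

/-! ### The homotopy colimit of a sequence of finite-dimensional modules -/

section

variable {m : ℕ ⥤ Rep.{u} k G} {H : StMod w}
  {t' : (toStable w).obj (∐ fun i => m.obj i) ⟶ H}
  {δ : H ⟶ (shift w).obj ((toStable w).obj (∐ fun i => m.obj i))}

theorem IsHocolim.locFD [∀ i, FiniteDimensional k (m.obj i).V] (hH : IsHocolim m t' δ) : locFD w H := by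
  have h : RelStable.locFD w ((toStable w).obj (∐ fun i => m.obj i)) :=
    isLocalizing_locFD.coproduct _ _ _ (isColimitToStableSigma fun i => m.obj i)
      fun i => locFD_toStable _
  exact isLocalizing_locFD.cone _ hH h h

omit [FiniteDimensional k w.V] [Nontrivial w.V] in
/-- Composition with `1 - s` is injective on stable maps from a finite-dimensional module. -/
theorem eq_zero_of_comp_oneSubShift {x : Rep.{u} k G} [FiniteDimensional k x.V]
    (φ : (toStable w).obj x ⟶ (toStable w).obj (∐ fun i => m.obj i))
    (h : φ ≫ (toStable w).map (oneSubShift m) = 0) : φ = 0 := by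
  obtain ⟨φ, rfl⟩ := (toStable w).map_surjective φ
  have hφ : ∀ j, (toStable w).map (φ ≫ Sigma.π (fun i => m.obj i) j) = 0 := by
    intro j
    induction j with
    | zero =>
      rw [← oneSubShift_comp_π_zero, Functor.map_comp, Functor.map_comp, reassoc_of% h, zero_comp]
    | succ j ih =>
      have h₁ := congr($h ≫ (toStable w).map (Sigma.π (fun i => m.obj i) (j + 1)))
      rw [zero_comp, Category.assoc, ← Functor.map_comp, oneSubShift_comp_π_succ, Functor.map_sub,
        Preadditive.comp_sub, Functor.map_comp, ← Functor.map_comp_assoc, ih, zero_comp,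
        sub_zero] at h₁
      rw [Functor.map_comp, h₁]
  -- Null components suffice because only finitely many of them occur.
  obtain ⟨n, hn⟩ := exists_eq_sum_comp_π φ
  rw [hn, Functor.map_sum]
  exact Finset.sum_eq_zero fun j _ => by rw [Functor.map_comp, hφ, zero_comp]

omit [Nontrivial w.V] in
theorem IsHocolim.ι_comp (hH : IsHocolim m t' δ) {i j : ℕ} (hij : i ≤ j) :
    (toStable w).map (m.map (homOfLE hij)) ≫ (toStable w).map (Sigma.ι (fun i => m.obj i) j) ≫ t' =
      (toStable w).map (Sigma.ι (fun i => m.obj i) i) ≫ t' := by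
  induction j, hij using Nat.le_induction with
  | base =>
    have : m.map (homOfLE (le_refl i)) = 𝟙 _ := m.map_id i
    rw [this, CategoryTheory.Functor.map_id, Category.id_comp]
  | succ j hij ih =>
    have h₁ : (toStable w).map (oneSubShift m) ≫ t' = 0 := Tri.Distinguished.comp_eq_zero hH
    have h₂ := congr((toStable w).map (Sigma.ι (fun i => m.obj i) j) ≫ $h₁)
    rw [← Functor.map_comp_assoc, ι_comp_oneSubShift, comp_zero, Functor.map_sub,
      Preadditive.sub_comp, sub_eq_zero, Functor.map_comp, Category.assoc] at h₂
    have h₃ : m.map (homOfLE (hij.trans (Nat.le_succ j))) =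
        m.map (homOfLE hij) ≫ m.map (homOfLE (Nat.le_succ j)) := by
      rw [← m.map_comp]; rfl
    rw [← ih, h₂, h₃, Functor.map_comp, Category.assoc]

/-- A map from a finite-dimensional module to the homotopy colimit factors through some stage. -/
theorem IsHocolim.exists_factor (hH : IsHocolim m t' δ) {x : Rep.{u} k G}
    [FiniteDimensional k x.V] (φ : (toStable w).obj x ⟶ H) :
    ∃ (n : ℕ) (ψ : x ⟶ m.obj n), (toStable w).map ψ ≫
      (toStable w).map (Sigma.ι (fun i => m.obj i) n) ≫ t' = φ := by
  obtain ⟨i⟩ := nonempty_iso_shift_syzygy (w := w) x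
  have : FiniteDimensional k (syzygy w x).V := finiteDimensional_of_mono (kernel.ι _)
  -- Up to shift, `φ ≫ δ` is a map from the finite-dimensional `Ω_w x` to `⨁ m i` that is killed by
  -- `1 - s`.
  have hδ : φ ≫ δ = 0 := by
    obtain ⟨θ, hθ⟩ := (shift w).map_surjective (i.inv ≫ φ ≫ δ)
    have h₁ : δ ≫ (shift w).map ((toStable w).map (oneSubShift m)) = 0 :=
      Tri.Distinguished.comp_shift_map_eq_zero hH
    have h₂ : θ ≫ (toStable w).map (oneSubShift m) = 0 := by
      apply (shift w).map_injective
      rw [Functor.map_comp, hθ, Category.assoc, Category.assoc, h₁, comp_zero, comp_zero,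
        Functor.map_zero]
    rw [← cancel_epi i.inv, ← hθ, eq_zero_of_comp_oneSubShift θ h₂, Functor.map_zero, comp_zero]
  obtain ⟨φ, rfl⟩ := Tri.Distinguished.coyoneda_exact₃ hH φ hδ
  obtain ⟨φ, rfl⟩ := (toStable w).map_surjective φ
  obtain ⟨n, hn⟩ := exists_eq_sum_comp_π φ
  suffices ∀ n, ∃ ψ : x ⟶ m.obj n, (toStable w).map ψ ≫
      (toStable w).map (Sigma.ι (fun i => m.obj i) n) ≫ t' =
      (toStable w).map (∑ j ∈ Finset.range n, (φ ≫ Sigma.π (fun i => m.obj i) j) ≫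
        Sigma.ι (fun i => m.obj i) j) ≫ t' by
    obtain ⟨ψ, hψ⟩ := this n
    exact ⟨n, ψ, by rw [hψ, ← hn]⟩
  intro n
  induction n with
  | zero => exact ⟨0, by simp⟩
  | succ n ih =>
    obtain ⟨ψ, hψ⟩ := ih
    -- The partial sum of the components below `n` is represented at stage `n`; adding component `n`
    -- and moving to stage `n + 1` changes nothing after `t'`.
    refine ⟨(ψ + φ ≫ Sigma.π (fun i => m.obj i) n) ≫ m.map (homOfLE (Nat.le_succ n)), ?_⟩
    rw [Functor.map_comp, Category.assoc, hH.ι_comp, Finset.sum_range_succ, Functor.map_add,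
      Functor.map_add, Preadditive.add_comp, Preadditive.add_comp, hψ,
      Functor.map_comp _ _ (Sigma.ι (fun i => m.obj i) n), Category.assoc]

variable {c : Cocone m} {lam : H ⟶ (toStable w).obj c.pt}

omit [FiniteDimensional k w.V] [Nontrivial w.V] in
theorem IsHocolim.ι_comp_lam (hlam : t' ≫ lam = (toStable w).map (sumMap c)) (i : ℕ) :
    (toStable w).map (Sigma.ι (fun i => m.obj i) i) ≫ t' ≫ lam = (toStable w).map (c.ι.app i) := by
  rw [hlam, ← Functor.map_comp, ι_comp_sumMap]

/-- A null composite to `M` factors through the hull of `x`. The hull is finite-dimensional, so its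
map to `M` comes from a stage, and the equality of the two maps from `x` holds at a later stage,
where it shows that the representative is stably zero. -/
theorem IsHocolim.eq_zero_of_comp_lam [Finite G] (hc : IsColimit c) (hH : IsHocolim m t' δ)
    (hlam : t' ≫ lam = (toStable w).map (sumMap c)) {x : Rep.{u} k G} [FiniteDimensional k x.V]
    (φ : (toStable w).obj x ⟶ H) (h : φ ≫ lam = 0) : φ = 0 := by
  obtain ⟨n, ψ, rfl⟩ := hH.exists_factor φ
  rw [Category.assoc, Category.assoc, ι_comp_lam hlam, ← Functor.map_comp] at h
  obtain ⟨u, a, ha⟩ : ∃ (u : x ⟶ (hull w).obj x) (a : (hull w).obj x ⟶ c.pt),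
      u ≫ a = ψ ≫ c.ι.app n := ⟨_, exists_hullUnit_comp_eq h⟩
  obtain ⟨j, b, hb⟩ := exists_comp_ι_eq hc a
  have h₁ : (ψ ≫ m.map (homOfLE (le_max_left n j)) - u ≫ b ≫
      m.map (homOfLE (le_max_right n j))) ≫ c.ι.app (max n j) = 0 := by
    simp only [Preadditive.sub_comp, Category.assoc, map_comp_ι, hb, ha, sub_self]
  obtain ⟨l, hl, h₂⟩ := exists_comp_map_eq_zero hc _ h₁
  rw [Preadditive.sub_comp, sub_eq_zero] at h₂
  have h₃ : (toStable w).map ((ψ ≫ m.map (homOfLE (le_max_left n j))) ≫ m.map (homOfLE hl)) = 0 := by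
    rw [h₂, Category.assoc]
    exact toStable_map_comp_eq_zero (isRelProjective_tensor w _) _ _
  rw [← hH.ι_comp (le_max_left n j), ← hH.ι_comp hl, ← Functor.map_comp_assoc,
    ← Functor.map_comp_assoc, h₃, zero_comp]

omit [FiniteDimensional k w.V] [Nontrivial w.V] in
theorem IsHocolim.exists_comp_lam_eq [Finite G] (hc : IsColimit c) (hlam : t' ≫ lam = (toStable w).map (sumMap c))
    {x : Rep.{u} k G} [FiniteDimensional k x.V] (φ : (toStable w).obj x ⟶ (toStable w).obj c.pt) :
    ∃ ψ : (toStable w).obj x ⟶ H, ψ ≫ lam = φ := by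
  obtain ⟨φ, rfl⟩ := (toStable w).map_surjective φ
  obtain ⟨i, g, rfl⟩ := exists_comp_ι_eq hc φ
  exact ⟨(toStable w).map g ≫ (toStable w).map (Sigma.ι (fun i => m.obj i) i) ≫ t', by
    rw [Category.assoc, Category.assoc, ι_comp_lam hlam, ← Functor.map_comp]⟩

/-- Injectivity of composition with `lam` on maps from `Ω_w x` gives `φ ≫ h = 0`, so `φ` comes from
a map to `M`; surjectivity on maps from `x` lifts that map to `H`, and `lam ≫ g = 0`. -/
theorem IsHocolim.fdLocal [Finite G] (hc : IsColimit c) (hH : IsHocolim m t' δ)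
    (hlam : t' ≫ lam = (toStable w).map (sumMap c)) {M' : StMod w}
    {g : (toStable w).obj c.pt ⟶ M'} {h : M' ⟶ (shift w).obj H}
    (hT : Tri.Distinguished ⟨lam, g, h⟩) : fdLocal w M' := by
  intro x _ φ
  obtain ⟨i⟩ := nonempty_iso_shift_syzygy (w := w) x
  have : FiniteDimensional k (syzygy w x).V := finiteDimensional_of_mono (kernel.ι _)
  have hφ : φ ≫ h = 0 := by
    obtain ⟨θ, hθ⟩ := (shift w).map_surjective (i.inv ≫ φ ≫ h)
    have h₁ : h ≫ (shift w).map lam = 0 := hT.comp_shift_map_eq_zero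
    have h₂ : θ ≫ lam = 0 := by
      apply (shift w).map_injective
      rw [Functor.map_comp, hθ, Category.assoc, Category.assoc, h₁, comp_zero, comp_zero,
        Functor.map_zero]
    rw [← cancel_epi i.inv, ← hθ, hH.eq_zero_of_comp_lam hc hlam θ h₂, Functor.map_zero, comp_zero]
  obtain ⟨φ, rfl⟩ := hT.coyoneda_exact₃ φ hφ
  obtain ⟨φ, rfl⟩ := IsHocolim.exists_comp_lam_eq hc hlam φ
  have h₃ : lam ≫ g = 0 := hT.comp_eq_zero
  dsimp only
  rw [Category.assoc, h₃, comp_zero]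

end

/-! ### Bousfield triangles -/

theorem isBousfield_of_fdLocal {T : Tri w} (hT : T.Distinguished) (hX : locFD w T.X)
    (hZ : fdLocal w T.Z) : IsBousfield (locFD w) T where
  distinguished := hT
  mem := hX
  factors _ hl φ := hT.coyoneda_exact₂ φ (eq_zero_of_locFD hl hZ _)
  isLocal _ hl φ := eq_zero_of_locFD hl hZ φ

/-- The shift of `φ - ψ` factors through a map from the shift of `l` to the local object `T.Z`, and
that map is zero. -/
theorem IsBousfield.hom_ext {L : ObjectProperty (StMod w)} (hL : ∀ X, L X → L ((shift w).obj X))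
    {T : Tri w} (hT : IsBousfield L T) {l : StMod w} (hl : L l) {φ ψ : l ⟶ T.X}
    (h : φ ≫ T.f = ψ ≫ T.f) : φ = ψ := by
  apply (shift w).map_injective
  rw [← sub_eq_zero, ← Functor.map_sub]
  obtain ⟨θ, hθ⟩ := hT.distinguished.coyoneda_exact₁ ((shift w).map (φ - ψ)) (by
    rw [← Functor.map_comp, Preadditive.sub_comp, h, sub_self, Functor.map_zero])
  rw [← hθ, hT.isLocal _ (hL l hl) θ, zero_comp]

/-- Bousfield triangles of the same object are uniquely isomorphic. -/
theorem IsBousfield.existsUnique_iso {L : ObjectProperty (StMod w)}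
    (hL : ∀ X, L X → L ((shift w).obj X)) {M H M' E F : StMod w} {lam : H ⟶ M} {g : M ⟶ M'}
    {h : M' ⟶ (shift w).obj H} {a : E ⟶ M} {b : M ⟶ F} {c : F ⟶ (shift w).obj E}
    (hT : IsBousfield L ⟨lam, g, h⟩) (hT' : IsBousfield L ⟨a, b, c⟩) :
    ∃! e : E ≅ H, e.hom ≫ lam = a ∧
      ∃ f : F ≅ M', b ≫ f.hom = g ∧ f.hom ≫ h = c ≫ (shift w).map e.hom := by
  obtain ⟨e, he⟩ : ∃ e : E ⟶ H, e ≫ lam = a := hT.factors E hT'.mem a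
  obtain ⟨e', he'⟩ : ∃ e' : H ⟶ E, e' ≫ a = lam := hT'.factors H hT.mem lam
  let i : E ≅ H :=
    { hom := e
      inv := e'
      hom_inv_id := hT'.hom_ext hL hT'.mem (by
        dsimp only
        rw [Category.assoc, he', he, Category.id_comp])
      inv_hom_id := hT.hom_ext hL hT.mem (by
        dsimp only
        rw [Category.assoc, he, he', Category.id_comp]) }
  obtain ⟨z, hz, hz'⟩ := hT'.distinguished.exists_completion hT.distinguished i.hom (𝟙 M)
    ((Category.comp_id a).trans he.symm)
  have := Tri.Distinguished.isIso_of_isIso (T := ⟨a, b, c⟩) (T' := ⟨lam, g, h⟩)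
    hT'.distinguished hT.distinguished i.hom (𝟙 M) z
    ((Category.comp_id a).trans he.symm) hz hz' i.isIso_hom inferInstance
  refine ⟨i, ⟨he, asIso z, hz.trans (Category.id_comp g), hz'.symm⟩, fun j hj => ?_⟩
  ext
  exact hT.hom_ext hL hT'.mem (hj.1.trans he.symm)

end

section

variable {k : Type u} [Field k] {G : Type v} [Group G]

/-! ### Modules of countable dimension -/

section

variable (M : Rep.{u} k G) {W : ℕ → Submodule k M.V} (hW : Monotone W)
  (hG : ∀ n g, W n ≤ (W n).comap (M.ρ g))

/-- The sequence of modules given by an increasing sequence of submodules. -/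
def submoduleSeq : ℕ ⥤ Rep.{u} k G where
  obj n := Rep.subrepresentation M (W n) (hG n)
  map f := Rep.ofHom ⟨Submodule.inclusion (hW (leOfHom f)), fun _ => rfl⟩
  map_id _ := rfl
  map_comp _ _ := rfl

/-- The inclusions of the terms of an increasing sequence of submodules. -/
def submoduleSeqι : submoduleSeq M hW hG ⟶ (Functor.const ℕ).obj M where
  app n := Rep.subtype M (W n) (hG n)
  naturality _ _ _ := rfl

instance (n : ℕ) : Mono ((submoduleSeqι M hW hG).app n) :=
  (Rep.mono_iff_injective _).2 Subtype.val_injective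

variable {M hW hG} in
theorem submoduleSeq_cocone_apply_eq (c : Cocone (submoduleSeq M hW hG)) {i j : ℕ} {x : M.V}
    (hi : x ∈ W i) (hj : x ∈ W j) : (c.ι.app i).hom ⟨x, hi⟩ = (c.ι.app j).hom ⟨x, hj⟩ := by
  have h : ∀ {i j : ℕ} (hij : i ≤ j) (hi : x ∈ W i),
      (c.ι.app i).hom ⟨x, hi⟩ = (c.ι.app j).hom ⟨x, hW hij hi⟩ := fun hij hi =>
    congr(($(c.w (homOfLE hij))).hom ⟨x, hi⟩).symm
  rw [h (le_max_left i j), h (le_max_right i j)]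

/-- A module is the direct limit of an increasing sequence of submodules that exhausts it. -/
def isColimitSubmoduleSeq (hM : ∀ x, ∃ n, x ∈ W n) :
    IsColimit (Cocone.mk M (submoduleSeqι M hW hG)) := by
  choose N hN using hM
  refine
    { desc := fun c => Rep.ofHom
        ⟨{  toFun := fun x => (c.ι.app (N x)).hom ⟨x, hN x⟩
            map_add' := fun x y => ?_
            map_smul' := fun r x => ?_ }, fun g => ?_⟩
      fac := fun c i => ?_
      uniq := fun c f hf => ?_ }
  · let j := max (N x) (N y)
    have hx : x ∈ W j := hW (le_max_left _ _) (hN x)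
    have hy : y ∈ W j := hW (le_max_right _ _) (hN y)
    rw [submoduleSeq_cocone_apply_eq c _ ((W j).add_mem hx hy),
      submoduleSeq_cocone_apply_eq c _ hx, submoduleSeq_cocone_apply_eq c _ hy]
    exact map_add (c.ι.app j).hom (⟨x, hx⟩ : W j) (⟨y, hy⟩ : W j)
  · rw [submoduleSeq_cocone_apply_eq c _ ((W (N x)).smul_mem r (hN x))]
    exact map_smul (c.ι.app (N x)).hom r ⟨x, hN x⟩
  · ext x
    exact (submoduleSeq_cocone_apply_eq c (hN (M.ρ g x)) (hG _ g (hN x))).trans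
      (Rep.hom_comm_apply (c.ι.app (N x)) g ⟨x, hN x⟩)
  · ext x
    exact submoduleSeq_cocone_apply_eq c _ x.2
  · ext x
    exact congr(($(hf (N x))).hom ⟨x, hN x⟩)

end

/-- A module of countable dimension is the direct limit of a sequence of finite-dimensional
submodules. -/
theorem exists_finiteDimensional_seq [Finite G] (M : Rep.{u} k G)
    (hM : Module.rank k M.V ≤ Cardinal.aleph0) :
    ∃ (m : ℕ ⥤ Rep.{u} k G) (ι : m ⟶ (Functor.const ℕ).obj M),
      (∀ i, FiniteDimensional k (m.obj i).V) ∧ (∀ i, Mono (ι.app i)) ∧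
        Nonempty (IsColimit (Cocone.mk M ι)) := by
  let b := Module.Basis.ofVectorSpace k M.V
  -- Inserting `0` makes the set nonempty, so that it can be enumerated by `ℕ` even if `M = 0`.
  have hb : (insert 0 (Set.range b)).Countable := by
    have : Countable (Module.Basis.ofVectorSpaceIndex k M.V) := by
      rw [← Cardinal.mk_le_aleph0_iff, b.mk_eq_rank'']
      exact hM
    exact (Set.countable_range b).insert 0
  obtain ⟨v, hv⟩ := hb.exists_eq_range (Set.insert_nonempty _ _)
  -- Spanning by the `G`-orbits of the first `n` vectors gives invariance; finiteness of `G` keeps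
  -- the dimension finite.
  let W : ℕ → Submodule k M.V := fun n => Submodule.span k {x | ∃ g, ∃ i < n, M.ρ g (v i) = x}
  have hW : Monotone W := fun n n' h => Submodule.span_mono fun x ⟨g, i, hi, hx⟩ =>
    ⟨g, i, hi.trans_le h, hx⟩
  have hG : ∀ n g, W n ≤ (W n).comap (M.ρ g) := by
    intro n g
    refine Submodule.span_le.2 ?_
    rintro _ ⟨g', i, hi, rfl⟩
    refine Submodule.subset_span ⟨g * g', i, hi, ?_⟩
    rw [map_mul]
    rfl
  have hfin : ∀ n, FiniteDimensional k (W n) := by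
    intro n
    refine FiniteDimensional.span_of_finite k ?_
    have : {x | ∃ g, ∃ i < n, M.ρ g (v i) = x} =
        Set.range fun p : G × Fin n => M.ρ p.1 (v p.2) := by
      ext x
      constructor
      · rintro ⟨g, i, hi, rfl⟩
        exact ⟨(g, ⟨i, hi⟩), rfl⟩
      · rintro ⟨p, rfl⟩
        exact ⟨p.1, p.2, p.2.2, rfl⟩
    rw [this]
    exact Set.finite_range _
  have htop : ⨆ n, W n = ⊤ := by
    rw [eq_top_iff, ← b.span_eq, Submodule.span_le]
    rintro _ ⟨a, rfl⟩
    obtain ⟨i, hi⟩ : b a ∈ Set.range v := hv ▸ Set.mem_insert_of_mem _ ⟨a, rfl⟩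
    refine Submodule.mem_iSup_of_mem (i + 1) (Submodule.subset_span ⟨1, i, i.lt_succ_self, ?_⟩)
    rw [map_one, hi]
    rfl
  exact ⟨submoduleSeq M hW hG, submoduleSeqι M hW hG, hfin, inferInstance,
    ⟨isColimitSubmoduleSeq M hW hG fun x =>
      (Submodule.mem_iSup_of_directed W hW.directed_le).1 (htop ▸ Submodule.mem_top)⟩⟩

/-! ### The case of the zero module -/

section

variable {w : Rep.{u} k G} [Subsingleton w.V]

theorem isZero_tensor_of_subsingleton (X : Rep.{u} k G) : IsZero (w ⊗ X) := by
  rw [Rep.isZero_iff]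
  have h : ∀ t : TensorProduct k w.V X.V, t = 0 := fun t => by
    induction t with
    | zero => rfl
    | tmul x y => rw [Subsingleton.elim x 0, TensorProduct.zero_tmul]
    | add x y hx hy => rw [hx, hy, add_zero]
  exact ⟨fun a b => (h a).trans (h b).symm⟩

theorem IsRelProjective.isZero {P : Rep.{u} k G} (hP : IsRelProjective w P) : IsZero P := by
  obtain ⟨X, ⟨r⟩⟩ := hP
  rw [IsZero.iff_id_eq_zero, ← r.retract, (isZero_tensor_of_subsingleton X).eq_zero_of_tgt r.i,
    zero_comp]

theorem toStable_map_injective {X Y : Rep.{u} k G} {f g : X ⟶ Y}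
    (h : (toStable w).map f = (toStable w).map g) : f = g := by
  rw [toStable_map_eq_iff, toStable_map_eq_zero_iff] at h
  obtain ⟨P, hP, a, b, e⟩ := h
  rw [← sub_eq_zero, ← e, hP.isZero.eq_zero_of_tgt a, zero_comp]

theorem isWSplit_of_shortExact {S : ShortComplex (Rep.{u} k G)} (hS : S.ShortExact) :
    IsWSplit w S :=
  ⟨hS, ⟨{ r := 0
          s := 0
          f_r := (isZero_tensor_of_subsingleton _).eq_of_src _ _
          s_g := (isZero_tensor_of_subsingleton _).eq_of_src _ _
          id := (isZero_tensor_of_subsingleton _).eq_of_src _ _ }⟩⟩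

variable [FiniteDimensional k w.V]

theorem isZero_preShift (X : Rep.{u} k G) : IsZero ((preShift w).obj X) := by
  rw [IsZero.iff_id_eq_zero, ← cancel_epi ((preShiftProj w).app X)]
  exact (isZero_tensor_of_subsingleton _).eq_of_src _ _

theorem isZero_shift (X : StMod w) : IsZero ((shift w).obj X) :=
  (toStable w).map_isZero (isZero_preShift X.as)

/-- The shift of `X` is zero, hence finite-dimensional, and `ℒ` contains an object as soon as it
contains its shift. -/
theorem locFD_of_subsingleton (X : StMod w) : locFD w X := fun P hP hx => by
  rw [← hP.shift_iff]
  have : Subsingleton ((preShift w).obj X.as).V := (Rep.isZero_iff k G _).1 (isZero_preShift X.as)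
  exact hx ((preShift w).obj X.as) inferInstance

/-- For `w = 0` no nonzero map is stably null, so the monomorphism `S.f` stays monic in the stable
category. -/
theorem Tri.Distinguished.mono_f {T : Tri w} (hT : T.Distinguished) : Mono T.f := by
  obtain ⟨S, δ, hS, -, a, b, c, ha, -⟩ := hT
  refine Preadditive.mono_of_cancel_zero _ fun {W} φ hφ => ?_
  obtain ⟨φ', hφ'⟩ := (toStable w).map_surjective (X := W.as) (φ ≫ a.hom)
  have h : (toStable w).map (φ' ≫ S.f) = (toStable w).map 0 := by
    rw [Functor.map_comp, hφ', Category.assoc, ← ha, reassoc_of% hφ, zero_comp, Functor.map_zero]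
  have := hS.1.mono_f
  rw [← cancel_mono a.hom, ← hφ', zero_of_comp_mono _ (toStable_map_injective h),
    Functor.map_zero, zero_comp]

theorem Tri.Distinguished.epi_g {T : Tri w} (hT : T.Distinguished) : Epi T.g := by
  obtain ⟨S, δ, hS, -, a, b, c, -, hb, -⟩ := hT
  refine Preadditive.epi_of_cancel_zero _ fun {W} φ hφ => ?_
  obtain ⟨φ', hφ'⟩ := (toStable w).map_surjective (Y := W.as) (c.inv ≫ φ)
  have h : (toStable w).map (S.g ≫ φ') = (toStable w).map 0 := by
    rw [Functor.map_comp, hφ', ← cancel_epi b.hom, ← reassoc_of% hb, c.hom_inv_id_assoc, hφ,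
      Functor.map_zero, comp_zero]
  have := hS.1.epi_g
  rw [← cancel_epi c.inv, ← hφ', zero_of_epi_comp _ (toStable_map_injective h),
    Functor.map_zero, comp_zero]

end

/-! ### The short exact sequence presenting a direct limit -/

section

variable {m : ℕ ⥤ Rep.{u} k G} {c : Cocone m}

theorem mono_oneSubShift : Mono (oneSubShift m) := by
  refine Preadditive.mono_of_cancel_zero _ fun {W} φ h => ?_
  have hφ : ∀ j, φ ≫ Sigma.π (fun i => m.obj i) j = 0 := by
    intro j
    induction j with
    | zero => rw [← oneSubShift_comp_π_zero, reassoc_of% h, zero_comp]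
    | succ j ih =>
      have h₁ := congr($h ≫ Sigma.π (fun i => m.obj i) (j + 1))
      rwa [zero_comp, Category.assoc, oneSubShift_comp_π_succ, Preadditive.comp_sub,
        ← Category.assoc, ih, zero_comp, sub_zero] at h₁
  ext x
  obtain ⟨n, hn⟩ := exists_sum_π_apply_eq (X := fun i => m.obj i) (φ.hom x)
  have h₂ : φ ≫ (∑ j ∈ Finset.range n, Sigma.π (fun i => m.obj i) j ≫
      Sigma.ι (fun i => m.obj i) j) = 0 := by
    rw [Preadditive.comp_sum]
    exact Finset.sum_eq_zero fun j _ => by rw [← Category.assoc, hφ, zero_comp]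
  exact (hn n le_rfl).symm.trans congr(($h₂).hom x)

/-- The direct limit is the cokernel of `1 - s`. -/
theorem shortExact_oneSubShift (hc : IsColimit c) :
    (ShortComplex.mk _ _ (oneSubShift_comp_sumMap c)).ShortExact := by
  have hdesc : ∀ {W : Rep.{u} k G} (f : (∐ fun i => m.obj i) ⟶ W), oneSubShift m ≫ f = 0 →
      ∃ g : c.pt ⟶ W, sumMap c ≫ g = f := by
    intro W f hf
    have h : ∀ i, m.map (homOfLE (Nat.le_succ i)) ≫ Sigma.ι (fun i => m.obj i) (i + 1) ≫ f =
        Sigma.ι (fun i => m.obj i) i ≫ f := by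
      intro i
      have h₁ := congr(Sigma.ι (fun i => m.obj i) i ≫ $hf)
      rw [← Category.assoc, ι_comp_oneSubShift, comp_zero, Preadditive.sub_comp, sub_eq_zero,
        Category.assoc] at h₁
      exact h₁.symm
    let d : Cocone m := ⟨W, NatTrans.ofSequence (fun i => Sigma.ι (fun i => m.obj i) i ≫ f)
      (fun i => (h i).trans (Category.comp_id _).symm)⟩
    refine ⟨hc.desc d, Sigma.hom_ext _ _ fun i => ?_⟩
    rw [← Category.assoc, ι_comp_sumMap, hc.fac]
    rfl
  have hepi : Epi (sumMap c) := Preadditive.epi_of_cancel_zero _ fun φ hφ => hc.hom_ext fun i => by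
    rw [← ι_comp_sumMap, Category.assoc, hφ, comp_zero, comp_zero]
  exact
    { exact := ShortComplex.exact_of_g_is_cokernel _ (CokernelCofork.IsColimit.ofπ _ _
        (fun f hf => (hdesc f hf).choose) (fun f hf => (hdesc f hf).choose_spec)
        (fun f hf g hg => by rw [← cancel_epi (sumMap c), hg, (hdesc f hf).choose_spec]))
      mono_f := mono_oneSubShift
      epi_g := hepi }

end

end

/-! ### The comparison map, and Bousfield triangles for `w = 0` -/

section

variable {k : Type u} [Field k] {G : Type v} [Group G]

variable {w : Rep.{u} k G} [FiniteDimensional k w.V]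

/-- The canonical map from a homotopy colimit to the direct limit. -/
theorem IsHocolim.exists_comp_eq {m : ℕ ⥤ Rep.{u} k G} {H : StMod w}
    {t' : (toStable w).obj (∐ fun i => m.obj i) ⟶ H}
    {δ : H ⟶ (shift w).obj ((toStable w).obj (∐ fun i => m.obj i))} (hH : IsHocolim m t' δ)
    (c : Cocone m) : ∃ lam : H ⟶ (toStable w).obj c.pt, t' ≫ lam = (toStable w).map (sumMap c) :=
  Tri.Distinguished.yoneda_exact₂ hH _ (by
    dsimp only
    rw [← Functor.map_comp, oneSubShift_comp_sumMap, Functor.map_zero])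

section

variable [Subsingleton w.V]

theorem Tri.Distinguished.isZero_of_isIso {T : Tri w} (hT : T.Distinguished) (h : IsIso T.f) :
    IsZero T.Z := by
  have h₁ : T.g = 0 := by rw [← cancel_epi T.f, hT.comp_eq_zero, comp_zero]
  have := hT.epi_g
  rw [IsZero.iff_id_eq_zero, ← cancel_epi T.g, h₁, zero_comp, zero_comp]

-- For `w = 0` only monomorphisms can begin a triangle, so completion is not available for every
-- map; an isomorphism is completed by `Y = Y ⟶ 0`.
open ZeroObject in
theorem exists_distinguished_of_isIso {X : StMod w} {Y : Rep.{u} k G} (f : X ⟶ (toStable w).obj Y)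
    [IsIso f] : ∃ (Z : StMod w) (g : (toStable w).obj Y ⟶ Z) (h : Z ⟶ (shift w).obj X),
      Tri.Distinguished ⟨f, g, h⟩ := by
  let S : ShortComplex (Rep.{u} k G) := ShortComplex.mk (𝟙 Y) (0 : Y ⟶ 0) comp_zero
  have hS : S.ShortExact :=
    { exact := (ShortComplex.exact_iff_epi _ rfl).2 (inferInstanceAs (Epi (𝟙 Y)))
      mono_f := inferInstanceAs (Mono (𝟙 Y))
      epi_g := (isZero_zero _).epi _ }
  refine ⟨(toStable w).obj 0, (toStable w).map 0, 0,
    distinguished_of_seq (δ := 0) (isWSplit_of_shortExact hS)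
      ⟨0, (isZero_tensor_of_subsingleton _).eq_of_tgt _ _, (isZero_preShift _).eq_of_tgt _ _⟩
      (asIso f) (Iso.refl _) (Iso.refl _) ?_ ?_ ((isZero_shift _).eq_of_tgt _ _)⟩
  · exact congrArg (f ≫ ·) ((toStable w).map_id Y).symm
  · exact (Category.comp_id _).trans (Category.id_comp _).symm

/-- Both `t'` and the map to the direct limit are epimorphisms through which every map killed by `1
- s` factors, that is, cokernels of `1 - s`. -/
theorem IsHocolim.isIso {m : ℕ ⥤ Rep.{u} k G} {c : Cocone m} (hc : IsColimit c) {H : StMod w}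
    {t' : (toStable w).obj (∐ fun i => m.obj i) ⟶ H}
    {δ : H ⟶ (shift w).obj ((toStable w).obj (∐ fun i => m.obj i))} (hH : IsHocolim m t' δ)
    {lam : H ⟶ (toStable w).obj c.pt} (hlam : t' ≫ lam = (toStable w).map (sumMap c)) :
    IsIso lam := by
  obtain ⟨δ', hδ'⟩ := (isWSplit_of_shortExact (w := w)
    (shortExact_oneSubShift hc)).exists_distinguished
  have h₁ : Epi ((toStable w).map (sumMap c)) := hδ'.epi_g
  have h₂ : Epi t' := Tri.Distinguished.epi_g hH
  obtain ⟨μ, hμ⟩ : ∃ μ : (toStable w).obj c.pt ⟶ H, (toStable w).map (sumMap c) ≫ μ = t' :=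
    hδ'.yoneda_exact₂ t' (Tri.Distinguished.comp_eq_zero hH)
  exact ⟨μ, by rw [← cancel_epi t', reassoc_of% hlam, hμ, Category.comp_id],
    by rw [← cancel_epi ((toStable w).map (sumMap c)), reassoc_of% hμ, hlam, Category.comp_id]⟩

theorem isBousfield_of_isIso {T : Tri w} (hT : T.Distinguished) (h : IsIso T.f) :
    IsBousfield (locFD w) T where
  distinguished := hT
  mem := locFD_of_subsingleton _
  factors _ _ φ := ⟨φ ≫ inv T.f, by rw [Category.assoc, IsIso.inv_hom_id, Category.comp_id]⟩
  isLocal _ _ φ := (hT.isZero_of_isIso h).eq_zero_of_tgt φ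

theorem IsBousfield.isZero {T : Tri w} (hT : IsBousfield (locFD w) T) : IsZero T.Z := by
  rw [IsZero.iff_id_eq_zero]
  exact hT.isLocal _ (locFD_of_subsingleton _) _

/-- Every object lies in `ℒ`, so locality makes `T.Z` zero; the monomorphism `T.f` then acquires a
section by exactness. -/
theorem IsBousfield.isIso {T : Tri w} (hT : IsBousfield (locFD w) T) : IsIso T.f := by
  have := hT.distinguished.mono_f
  obtain ⟨s, hs⟩ := hT.distinguished.coyoneda_exact₂ (𝟙 T.Y) (hT.isZero.eq_zero_of_tgt _)
  have : IsSplitEpi T.f := ⟨⟨⟨s, hs⟩⟩⟩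
  exact isIso_of_mono_of_isSplitEpi _

theorem IsBousfield.existsUnique_iso_of_subsingleton {M H M' E F : StMod w} {lam : H ⟶ M}
    {g : M ⟶ M'} {h : M' ⟶ (shift w).obj H} {a : E ⟶ M} {b : M ⟶ F} {c : F ⟶ (shift w).obj E}
    (hT : IsBousfield (locFD w) ⟨lam, g, h⟩) (hT' : IsBousfield (locFD w) ⟨a, b, c⟩) :
    ∃! e : E ≅ H, e.hom ≫ lam = a ∧
      ∃ f : F ≅ M', b ≫ f.hom = g ∧ f.hom ≫ h = c ≫ (shift w).map e.hom := by
  have : IsIso lam := hT.isIso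
  have : IsIso a := hT'.isIso
  refine ⟨asIso a ≪≫ (asIso lam).symm, ⟨by simp, hT'.isZero.iso hT.isZero,
    hT.isZero.eq_of_tgt _ _, hT'.isZero.eq_of_src _ _⟩, fun e he => ?_⟩
  ext
  rw [← cancel_mono lam, he.1]
  simp

end

end

end RelStable

end

/-! ### Assembly of the main theorem -/

open RelStable
theorem mainTheorem1 {k : Type u} [Field k] {G : Type v} [Group G] [Finite G]
    (w : Rep.{u} k G) [FiniteDimensional k w.V]
    (M : Rep.{u} k G) (hM : Module.rank k M.V ≤ Cardinal.aleph0) :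
    -- `M` is the direct limit of a sequence of finite-dimensional submodules
    (∃ (m : ℕ ⥤ Rep.{u} k G) (ι : m ⟶ (Functor.const ℕ).obj M),
      (∀ i, FiniteDimensional k (m.obj i).V) ∧ (∀ i, Mono (ι.app i)) ∧
        Nonempty (IsColimit (Cocone.mk M ι))) ∧
    -- for every sequence of finite-dimensional modules with direct limit `M`:
    ∀ (m : ℕ ⥤ Rep.{u} k G) (ι : m ⟶ (Functor.const ℕ).obj M),
      (∀ i, FiniteDimensional k (m.obj i).V) → IsColimit (Cocone.mk M ι) →
    -- the homotopy colimit exists,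
    (∃ (H : StMod w) (t' : (toStable w).obj (∐ fun i => m.obj i) ⟶ H)
      (δ : H ⟶ (shift w).obj ((toStable w).obj (∐ fun i => m.obj i))), IsHocolim m t' δ) ∧
    -- and each homotopy colimit has a canonical map to `M`,
    ∀ (H : StMod w) (t' : (toStable w).obj (∐ fun i => m.obj i) ⟶ H)
      (δ : H ⟶ (shift w).obj ((toStable w).obj (∐ fun i => m.obj i))), IsHocolim m t' δ →
    (∃ lam : H ⟶ (toStable w).obj M, t' ≫ lam = (toStable w).map (sumMap (Cocone.mk M ι))) ∧
    ∀ lam : H ⟶ (toStable w).obj M, t' ≫ lam = (toStable w).map (sumMap (Cocone.mk M ι)) →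
    -- which completes to a distinguished triangle;
    (∃ (M' : StMod w) (g : (toStable w).obj M ⟶ M') (h : M' ⟶ (shift w).obj H),
      Tri.Distinguished ⟨lam, g, h⟩) ∧
    ∀ (M' : StMod w) (g : (toStable w).obj M ⟶ M') (h : M' ⟶ (shift w).obj H),
      Tri.Distinguished ⟨lam, g, h⟩ →
    -- every such triangle is a Bousfield triangle of `M`,
    IsBousfield (locFD w) ⟨lam, g, h⟩ ∧
    -- and every Bousfield triangle `E ⟶ M ⟶ F` of `M` is isomorphic to it over `M`.
    ∀ (E F : StMod w) (a : E ⟶ (toStable w).obj M) (b : (toStable w).obj M ⟶ F)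
      (c : F ⟶ (shift w).obj E), IsBousfield (locFD w) ⟨a, b, c⟩ →
      ∃! e : E ≅ H, e.hom ≫ lam = a ∧
        ∃ f : F ≅ M', b ≫ f.hom = g ∧ f.hom ≫ h = c ≫ (shift w).map e.hom := by
  refine ⟨exists_finiteDimensional_seq M hM, fun m ι hm hι => ?_⟩
  have hS : ∀ X, locFD w X → locFD w ((shift w).obj X) := fun X =>
    (isLocalizing_locFD.shift_iff X).2
  -- For `w = 0` the shift is zero and the triangulated arguments fail, so this case is treated
  -- through the module category.
  rcases subsingleton_or_nontrivial w.V with hw | hw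
  · obtain ⟨δ, hδ⟩ :=
      (isWSplit_of_shortExact (w := w) (shortExact_oneSubShift hι)).exists_distinguished
    refine ⟨⟨_, _, _, hδ⟩, fun H t' δ hH => ⟨hH.exists_comp_eq (Cocone.mk M ι), fun lam hlam => ?_⟩⟩
    have hiso : IsIso lam := hH.isIso hι hlam
    refine ⟨exists_distinguished_of_isIso lam, fun M' g h hT => ?_⟩
    have hB : IsBousfield (locFD w) ⟨lam, g, h⟩ := isBousfield_of_isIso hT hiso
    exact ⟨hB, fun E F a b c hB' => hB.existsUnique_iso_of_subsingleton hB'⟩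
  · refine ⟨exists_distinguished _, fun H t' δ hH => ⟨hH.exists_comp_eq (Cocone.mk M ι), fun lam hlam => ?_⟩⟩
    refine ⟨exists_distinguished lam, fun M' g h hT => ?_⟩
    have hB : IsBousfield (locFD w) ⟨lam, g, h⟩ :=
      isBousfield_of_fdLocal hT hH.locFD (hH.fdLocal hι hlam hT)
    exact ⟨hB, fun E F a b c hB' => hB.existsUnique_iso hS hB'⟩
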